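/- Let $\phi$ be a commutative unital ring in which $2$ is invertible, and let $A=A_0\oplus A_1$ be an associative superalgebra over $\phi$ (not necessarily unital), that is, a $\mathbb Z/2$-graded associative $\phi$-algebra; no superinvolution is assumed. Ideals of a superalgebra are two-sided graded ideals ($\phi$-submodules), and $A$ is assumed to be prime: the product of two nonzero ideals is nonzero. Let $Z$ be the even part of the (ordinary) center of $A$, and for $a\in A_i$, $b\in A_j$ put $[a,b]=ab-(-1)^{ij}ba$ and $a\circ b=ab+(-1)^{ij}ba$, extended biadditively to $A$. Let $I$ be a nonzero proper ideal of $A$, and let $U$ be an additive subgroup of $A$ such that $[u,y]\in U$ for all $u\in U$ and $y\in I$, $u\circ v\in Z$ for all $u,v\in U\cap A_0$, and $u\circ v=0$ for all $u,v\in U\cap A_1$. Then at least one of the following holds: 1. $A$ is commutative (that is, $ab=ba$ for all $a,b\in A$); 2. $A$ is a central order in a $4$-dimensional simple superalgebra, that is, $Z\neq 0$ and the localization $Z^{-1}A=\{z^{-1}a : 0\neq z\in Z,\ a\in A\}$ is a simple superalgebra of dimension $4$ over the field $Z^{-1}Z$; 3. $U\subseteq Z$. -/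

import Mathlib

namespace Superalgebra

universe u

/-! A (not necessarily unital) associative superalgebra over a commutative ring `R` is given by a
non-unital associative `R`-algebra `A` together with a `ZMod 2`-grading `𝒜` by `R`-submodules
(`SetLike.GradedMul 𝒜` and `DirectSum.Decomposition 𝒜`). -/

section Basic

variable {R A : Type*} [CommRing R] [NonUnitalRing A] [Module R A]
  (𝒜 : ZMod 2 → Submodule R A) [DirectSum.Decomposition 𝒜]

/-- The homogeneous component of degree `i` of `a`. -/
def comp (a : A) (i : ZMod 2) : A := (DirectSum.decompose 𝒜 a i : A)

/-- The superbracket: the biadditive extension of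
`[a, b] = a b - (-1) ^ (i j) b a` for `a` of degree `i` and `b` of degree `j`. -/
def superbracket (a b : A) : A :=
  ∑ i : ZMod 2, ∑ j : ZMod 2,
    (comp 𝒜 a i * comp 𝒜 b j - (-1 : ℤ) ^ (i.val * j.val) • (comp 𝒜 b j * comp 𝒜 a i))

/-- The Jordan superproduct: the biadditive extension of
`a ∘ b = a b + (-1) ^ (i j) b a` for `a` of degree `i` and `b` of degree `j`. -/
def superjordan (a b : A) : A :=
  ∑ i : ZMod 2, ∑ j : ZMod 2,
    (comp 𝒜 a i * comp 𝒜 b j + (-1 : ℤ) ^ (i.val * j.val) • (comp 𝒜 b j * comp 𝒜 a i))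

/-- The even part `Z` of the centre (in the ordinary sense) of `A`. -/
def evenCenter : Set A := {z | z ∈ 𝒜 0 ∧ ∀ a : A, z * a = a * z}

/-- Ideals of a superalgebra: two-sided ideals which are graded `R`-submodules. -/
structure IsSuperideal (I : Submodule R A) : Prop where
  mul_mem_left : ∀ (a : A) {y : A}, y ∈ I → a * y ∈ I
  mul_mem_right : ∀ (a : A) {y : A}, y ∈ I → y * a ∈ I
  comp_mem : ∀ {y : A}, y ∈ I → ∀ i : ZMod 2, comp 𝒜 y i ∈ I

/-- A superalgebra is prime if the product of two nonzero ideals is nonzero. -/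
def IsPrimeSuperalgebra : Prop :=
  ∀ I J : Submodule R A, IsSuperideal 𝒜 I → IsSuperideal 𝒜 J →
    (∀ x ∈ I, ∀ y ∈ J, x * y = 0) → I = ⊥ ∨ J = ⊥

/-- A superalgebra is simple if its multiplication is nonzero and it has no nonzero proper
ideals. -/
def IsSimpleSuperalgebra : Prop :=
  (∃ a b : A, a * b ≠ 0) ∧ ∀ I : Submodule R A, IsSuperideal 𝒜 I → I = ⊥ ∨ I = ⊤

end Basic

section CentralOrder

variable {R A : Type*} [CommRing R] [NonUnitalRing A] [Module R A] (𝒜 : ZMod 2 → Submodule R A)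

/-- With `Z` the even part of the centre of `A`, the map `ι` identifies the superalgebra `Q` over
the field `F` with the localization `Z⁻¹A = {z⁻¹ a : 0 ≠ z ∈ Z, a ∈ A}` over the field `Z⁻¹Z`:
`ι` is an embedding of graded rings carrying `Z` into `F`, every element of `Q` has the form
`(ι z)⁻¹ (ι a)`, and every element of `F` has the form `(ι z)⁻¹ (ι w)`, with `0 ≠ z ∈ Z`, `a ∈ A`
and `w ∈ Z`. (In particular `Z ≠ 0`.) -/
structure IsCentralOrder {F Q : Type*} [Field F] [Ring Q] [Algebra F Q]
    (ℬ : ZMod 2 → Submodule F Q) (ι : A →ₙ+* Q) : Prop where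
  injective : Function.Injective ι
  map_mem : ∀ (i : ZMod 2) {a : A}, a ∈ 𝒜 i → ι a ∈ ℬ i
  map_evenCenter : ∀ z ∈ evenCenter 𝒜, ∃ c : F, ι z = algebraMap F Q c
  exists_fraction : ∀ q : Q, ∃ z ∈ evenCenter 𝒜, z ≠ 0 ∧ ∃ a : A, ι z * q = ι a
  exists_scalar_fraction : ∀ c : F, ∃ z ∈ evenCenter 𝒜, z ≠ 0 ∧
    ∃ w ∈ evenCenter 𝒜, ι z * algebraMap F Q c = ι w

end CentralOrder

/-- `A` is a central order in an `n`-dimensional simple superalgebra: `Z⁻¹A` is a simple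
superalgebra of dimension `n` over the field `Z⁻¹Z`. -/
def IsCentralOrderInSimple {R : Type*} {A : Type u} [CommRing R] [NonUnitalRing A] [Module R A]
    (𝒜 : ZMod 2 → Submodule R A) (n : ℕ) : Prop :=
  ∃ (F Q : Type u) (_ : Field F) (_ : Ring Q) (_ : Algebra F Q)
    (ℬ : ZMod 2 → Submodule F Q) (_ : GradedAlgebra ℬ) (ι : A →ₙ+* Q),
    IsCentralOrder 𝒜 ℬ ι ∧ IsSimpleSuperalgebra ℬ ∧
      Module.Finite F Q ∧ Module.finrank F Q = n

end Superalgebra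

/-! The engine is the quaternion criterion `IsPrimeSuperalgebra.isCentralOrderInSimple`. Let an even
`a` and a homogeneous `b` anticommute, have nonzero squares in `Z`, and have their common
centralizer inside `Z`. Splitting an element according to whether it commutes or anticommutes with
`a` and with `b` writes it, up to a factor from `Z`, as a combination of `1, a, b, ab` over `Z`;
hence `A` is an order in a quaternion algebra over `Z⁻¹Z`. The rest is a search for such a pair.

The homogeneous elements of `U` come first (`IsPrimeSuperalgebra.homogeneous_trichotomy`). If `A₁ =
0` and `U ⊄ Z`, the pair consists of some `a ∈ U` and a commutator `[a, y]`. If `A₁ ≠ 0` but `U` has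
no nonzero odd element, the even elements of `U` commute with `I₁`, hence are central. If the odd
elements of `U` commute with `I₀`, a nonzero one is central and forces `I₀`, then `A`, to be
commutative. Otherwise some `c = [u, y] ≠ 0` is odd with `c² = 0` and `c I₀ c = 0`. For a suitable
odd `x` the elements `c` and `y = xcx` behave like off-diagonal 2×2 matrix units scaled by a central
`t`, and `cy - yc`, `c + y` is the pair (`IsPrimeSuperalgebra.isCentralOrderInSimple_of_nilpotent`).

`U` need not be graded, so there remains a `U` whose even elements lie in `Z` and whose odd elements
vanish. Then the components of the elements of `U ∩ I` supercommute modulo `Z`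
(`isSupercommutingPair_components`). If an odd component `q` has `q² ≠ 0`, then `A` is commutative
or `q` belongs to a quaternion pair. If all have square zero, a nonzero one satisfies the nilpotent
criterion. If all vanish, the odd components of elements of `U` are central, and a nonzero one puts
`I₀` into `Z` and makes `A` commutative. -/

namespace Superalgebra

set_option linter.unusedSectionVars false

/-! ### Homogeneous components and parity bookkeeping -/

section Components

variable {R A : Type*} [CommRing R] [NonUnitalRing A] [Module R A]
  (𝒜 : ZMod 2 → Submodule R A) [DirectSum.Decomposition 𝒜]

theorem comp_mem_grade (x : A) (i : ZMod 2) : comp 𝒜 x i ∈ 𝒜 i :=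
  (DirectSum.decompose 𝒜 x i).2

theorem comp_of_mem {x : A} {i : ZMod 2} (hx : x ∈ 𝒜 i) : comp 𝒜 x i = x :=
  DirectSum.decompose_of_mem_same 𝒜 hx

theorem comp_of_mem_ne {x : A} {i j : ZMod 2} (hx : x ∈ 𝒜 i) (hij : i ≠ j) : comp 𝒜 x j = 0 :=
  DirectSum.decompose_of_mem_ne 𝒜 hx hij

theorem comp_zero (i : ZMod 2) : comp 𝒜 0 i = 0 := by
  simp [comp]

theorem comp_add (x y : A) (i : ZMod 2) : comp 𝒜 (x + y) i = comp 𝒜 x i + comp 𝒜 y i := by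
  simp [comp]

theorem comp_add_comp (x : A) : comp 𝒜 x 0 + comp 𝒜 x 1 = x := by
  classical
  have h := DirectSum.sum_support_decompose 𝒜 x
  rw [Finset.sum_subset (Finset.subset_univ _)] at h
  · rw [show (Finset.univ : Finset (ZMod 2)) = {0, 1} from rfl,
      Finset.sum_pair (by decide)] at h
    exact h
  · intro i _ hi
    simpa using hi

theorem eq_zero_of_even_add_odd {x y : A} (hx : x ∈ 𝒜 0) (hy : y ∈ 𝒜 1) (h : x + y = 0) :
    x = 0 ∧ y = 0 := by
  have h0 := congrArg (fun t => comp 𝒜 t 0) h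
  have h1 := congrArg (fun t => comp 𝒜 t 1) h
  simp only [comp_add, comp_zero] at h0 h1
  rw [comp_of_mem 𝒜 hx, comp_of_mem_ne 𝒜 hy (by decide), add_zero] at h0
  rw [comp_of_mem 𝒜 hy, comp_of_mem_ne 𝒜 hx (by decide), zero_add] at h1
  exact ⟨h0, h1⟩

theorem eq_zero_of_even_of_odd {x : A} (hx : x ∈ 𝒜 0) (hy : x ∈ 𝒜 1) : x = 0 := by
  have := comp_of_mem_ne 𝒜 hx (show (0 : ZMod 2) ≠ 1 by decide)
  rwa [comp_of_mem 𝒜 hy] at this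

theorem sum_zmod_two {M : Type*} [AddCommMonoid M] (f : ZMod 2 → M) :
    ∑ i : ZMod 2, f i = f 0 + f 1 := by
  rw [show (Finset.univ : Finset (ZMod 2)) = {0, 1} from rfl, Finset.sum_pair (by decide)]

theorem superbracket_eq (a b : A) : superbracket 𝒜 a b =
    (comp 𝒜 a 0 * comp 𝒜 b 0 - comp 𝒜 b 0 * comp 𝒜 a 0) +
    (comp 𝒜 a 0 * comp 𝒜 b 1 - comp 𝒜 b 1 * comp 𝒜 a 0) +
    ((comp 𝒜 a 1 * comp 𝒜 b 0 - comp 𝒜 b 0 * comp 𝒜 a 1) +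
    (comp 𝒜 a 1 * comp 𝒜 b 1 + comp 𝒜 b 1 * comp 𝒜 a 1)) := by
  have h1 : (1 : ZMod 2).val = 1 := rfl
  have h0 : (0 : ZMod 2).val = 0 := rfl
  simp only [superbracket, sum_zmod_two, h0, h1]
  noncomm_ring

theorem superjordan_eq (a b : A) : superjordan 𝒜 a b =
    (comp 𝒜 a 0 * comp 𝒜 b 0 + comp 𝒜 b 0 * comp 𝒜 a 0) +
    (comp 𝒜 a 0 * comp 𝒜 b 1 + comp 𝒜 b 1 * comp 𝒜 a 0) +
    ((comp 𝒜 a 1 * comp 𝒜 b 0 + comp 𝒜 b 0 * comp 𝒜 a 1) +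
    (comp 𝒜 a 1 * comp 𝒜 b 1 - comp 𝒜 b 1 * comp 𝒜 a 1)) := by
  have h1 : (1 : ZMod 2).val = 1 := rfl
  have h0 : (0 : ZMod 2).val = 0 := rfl
  simp [superjordan, sum_zmod_two, h0, h1, sub_eq_add_neg]

theorem superbracket_even_right (a : A) {b : A} (hb : b ∈ 𝒜 0) : superbracket 𝒜 a b =
    (comp 𝒜 a 0 * b - b * comp 𝒜 a 0) + (comp 𝒜 a 1 * b - b * comp 𝒜 a 1) := by
  simp [superbracket_eq, comp_of_mem 𝒜 hb, comp_of_mem_ne 𝒜 hb (show (0 : ZMod 2) ≠ 1 by decide)]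

theorem superbracket_odd_right (a : A) {b : A} (hb : b ∈ 𝒜 1) : superbracket 𝒜 a b =
    (comp 𝒜 a 0 * b - b * comp 𝒜 a 0) + (comp 𝒜 a 1 * b + b * comp 𝒜 a 1) := by
  simp [superbracket_eq, comp_of_mem 𝒜 hb, comp_of_mem_ne 𝒜 hb (show (1 : ZMod 2) ≠ 0 by decide)]

theorem superjordan_even {a b : A} (ha : a ∈ 𝒜 0) (hb : b ∈ 𝒜 0) :
    superjordan 𝒜 a b = a * b + b * a := by
  simp [superjordan_eq, comp_of_mem 𝒜 hb, comp_of_mem_ne 𝒜 hb (show (0 : ZMod 2) ≠ 1 by decide),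
    comp_of_mem 𝒜 ha, comp_of_mem_ne 𝒜 ha (show (0 : ZMod 2) ≠ 1 by decide)]

theorem superjordan_odd {a b : A} (ha : a ∈ 𝒜 1) (hb : b ∈ 𝒜 1) :
    superjordan 𝒜 a b = a * b - b * a := by
  simp [superjordan_eq, comp_of_mem 𝒜 hb, comp_of_mem_ne 𝒜 hb (show (1 : ZMod 2) ≠ 0 by decide),
    comp_of_mem 𝒜 ha, comp_of_mem_ne 𝒜 ha (show (1 : ZMod 2) ≠ 0 by decide)]

theorem forall_of_homogeneous {p : A → Prop}
    (hadd : ∀ x y, p x → p y → p (x + y)) (h0 : ∀ w ∈ 𝒜 0, p w)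
    (h1 : ∀ w ∈ 𝒜 1, p w) (w : A) : p w := by
  rw [← comp_add_comp 𝒜 w]
  exact hadd _ _ (h0 _ (comp_mem_grade 𝒜 w 0)) (h1 _ (comp_mem_grade 𝒜 w 1))

end Components

section Grading

variable {R A : Type*} [CommRing R] [NonUnitalRing A] [Module R A]
  {𝒜 : ZMod 2 → Submodule R A} [SetLike.GradedMul 𝒜] {x y : A}

theorem even_mul_even (hx : x ∈ 𝒜 0) (hy : y ∈ 𝒜 0) : x * y ∈ 𝒜 0 :=
  SetLike.GradedMul.mul_mem hx hy

theorem even_mul_odd (hx : x ∈ 𝒜 0) (hy : y ∈ 𝒜 1) : x * y ∈ 𝒜 1 :=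
  SetLike.GradedMul.mul_mem hx hy

theorem odd_mul_even (hx : x ∈ 𝒜 1) (hy : y ∈ 𝒜 0) : x * y ∈ 𝒜 1 :=
  SetLike.GradedMul.mul_mem hx hy

theorem odd_mul_odd (hx : x ∈ 𝒜 1) (hy : y ∈ 𝒜 1) : x * y ∈ 𝒜 0 :=
  SetLike.GradedMul.mul_mem hx hy

end Grading

/-! ### Closure properties of the even centre; division by 2 -/

section Center

variable {R A : Type*} [CommRing R] [NonUnitalRing A] [Module R A]
  {𝒜 : ZMod 2 → Submodule R A} {x y z : A}

theorem evenCenter.zero_mem : (0 : A) ∈ evenCenter 𝒜 := ⟨(𝒜 0).zero_mem, by simp⟩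

theorem evenCenter.add_mem (hx : x ∈ evenCenter 𝒜) (hy : y ∈ evenCenter 𝒜) :
    x + y ∈ evenCenter 𝒜 :=
  ⟨(𝒜 0).add_mem hx.1 hy.1, fun a => by rw [add_mul, mul_add, hx.2, hy.2]⟩

theorem evenCenter.neg_mem (hx : x ∈ evenCenter 𝒜) : -x ∈ evenCenter 𝒜 :=
  ⟨(𝒜 0).neg_mem hx.1, fun a => by rw [neg_mul, mul_neg, hx.2]⟩

theorem evenCenter.sub_mem (hx : x ∈ evenCenter 𝒜) (hy : y ∈ evenCenter 𝒜) :
    x - y ∈ evenCenter 𝒜 := by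
  rw [sub_eq_add_neg]; exact evenCenter.add_mem hx (evenCenter.neg_mem hy)

theorem evenCenter.mul_mem [SetLike.GradedMul 𝒜] (hx : x ∈ evenCenter 𝒜)
    (hy : y ∈ evenCenter 𝒜) : x * y ∈ evenCenter 𝒜 :=
  ⟨even_mul_even hx.1 hy.1, fun a => by rw [mul_assoc, hy.2, ← mul_assoc, hx.2, mul_assoc]⟩

theorem eq_zero_of_add_self (h2 : IsUnit (2 : R)) (h : x + x = 0) : x = 0 := by
  rw [← two_smul R] at h
  exact (h2.smul_eq_zero).1 h

theorem mem_of_add_self_mem (h2 : IsUnit (2 : R)) {N : Submodule R A} (h : x + x ∈ N) :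
    x ∈ N := by
  obtain ⟨u, hu⟩ := h2
  rw [← two_smul R] at h
  have := N.smul_mem (↑u⁻¹ : R) h
  rwa [← hu, smul_smul, Units.inv_mul, one_smul] at this

theorem evenCenter.of_add_self (h2 : IsUnit (2 : R)) (h : x + x ∈ evenCenter 𝒜) :
    x ∈ evenCenter 𝒜 := by
  refine ⟨mem_of_add_self_mem h2 h.1, fun a => ?_⟩
  have := h.2 a
  rw [← sub_eq_zero]
  apply eq_zero_of_add_self h2
  linear_combination (norm := noncomm_ring) this

end Center

/-! ### Cancellation and centrality in prime superalgebras -/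

section Prime

variable {R A : Type*} [CommRing R] [NonUnitalRing A] [Module R A] [IsScalarTower R A A]
  [SMulCommClass R A A] {𝒜 : ZMod 2 → Submodule R A} [SetLike.GradedMul 𝒜]
  [DirectSum.Decomposition 𝒜] {I : Submodule R A}

/-- Primeness speaks only of graded ideals, so annihilators can be used only once they are known to
be graded. Against a homogeneous `w`, the products with the two components of `x` have different
parities and vanish separately. -/
theorem IsSuperideal.comp_mul_eq_zero_left (hI : IsSuperideal 𝒜 I) {x : A}
    (h : ∀ w ∈ I, x * w = 0) (i : ZMod 2) : ∀ w ∈ I, comp 𝒜 x i * w = 0 := by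
  have key : ∀ j, ∀ w ∈ I, w ∈ 𝒜 j → comp 𝒜 x 0 * w = 0 ∧ comp 𝒜 x 1 * w = 0 := by
    intro j w hw hj
    have e : comp 𝒜 x 0 * w + comp 𝒜 x 1 * w = 0 := by
      rw [← add_mul, comp_add_comp, h w hw]
    fin_cases j
    · exact eq_zero_of_even_add_odd 𝒜 (even_mul_even (comp_mem_grade 𝒜 x 0) hj)
        (odd_mul_even (comp_mem_grade 𝒜 x 1) hj) e
    · rw [add_comm] at e
      exact (eq_zero_of_even_add_odd 𝒜 (odd_mul_odd (comp_mem_grade 𝒜 x 1) hj)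
        (even_mul_odd (comp_mem_grade 𝒜 x 0) hj) e).symm
  intro w hw
  have k0 := key 0 _ (hI.comp_mem hw 0) (comp_mem_grade 𝒜 w 0)
  have k1 := key 1 _ (hI.comp_mem hw 1) (comp_mem_grade 𝒜 w 1)
  rw [← comp_add_comp 𝒜 w, mul_add]
  fin_cases i
  · exact (congrArg₂ (· + ·) k0.1 k1.1).trans (add_zero 0)
  · exact (congrArg₂ (· + ·) k0.2 k1.2).trans (add_zero 0)

theorem IsSuperideal.comp_mul_eq_zero_right (hI : IsSuperideal 𝒜 I) {x : A}
    (h : ∀ w ∈ I, w * x = 0) (i : ZMod 2) : ∀ w ∈ I, w * comp 𝒜 x i = 0 := by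
  have key : ∀ j, ∀ w ∈ I, w ∈ 𝒜 j → w * comp 𝒜 x 0 = 0 ∧ w * comp 𝒜 x 1 = 0 := by
    intro j w hw hj
    have e : w * comp 𝒜 x 0 + w * comp 𝒜 x 1 = 0 := by
      rw [← mul_add, comp_add_comp, h w hw]
    fin_cases j
    · exact eq_zero_of_even_add_odd 𝒜 (even_mul_even hj (comp_mem_grade 𝒜 x 0))
        (even_mul_odd hj (comp_mem_grade 𝒜 x 1)) e
    · rw [add_comm] at e
      exact (eq_zero_of_even_add_odd 𝒜 (odd_mul_odd hj (comp_mem_grade 𝒜 x 1))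
        (odd_mul_even hj (comp_mem_grade 𝒜 x 0)) e).symm
  intro w hw
  have k0 := key 0 _ (hI.comp_mem hw 0) (comp_mem_grade 𝒜 w 0)
  have k1 := key 1 _ (hI.comp_mem hw 1) (comp_mem_grade 𝒜 w 1)
  rw [← comp_add_comp 𝒜 w, add_mul]
  fin_cases i
  · exact (congrArg₂ (· + ·) k0.1 k1.1).trans (add_zero 0)
  · exact (congrArg₂ (· + ·) k0.2 k1.2).trans (add_zero 0)

/-- The left annihilator of a nonzero ideal of a prime superalgebra is zero. -/
theorem IsPrimeSuperalgebra.eq_zero_of_mul_left (hprime : IsPrimeSuperalgebra 𝒜)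
    (hI : IsSuperideal 𝒜 I) (hI0 : I ≠ ⊥) {x : A} (h : ∀ w ∈ I, x * w = 0) : x = 0 := by
  let J : Submodule R A :=
    { carrier := {x | ∀ w ∈ I, x * w = 0}
      add_mem' := fun {a b} ha hb w hw => by rw [add_mul, ha w hw, hb w hw, add_zero]
      zero_mem' := fun w _ => zero_mul w
      smul_mem' := fun r a ha w hw => by rw [smul_mul_assoc, ha w hw, smul_zero] }
  have hJ : IsSuperideal 𝒜 J :=
    { mul_mem_left := fun a y hy w hw => by rw [mul_assoc, hy w hw, mul_zero]
      mul_mem_right := fun a y hy w hw => by rw [mul_assoc, hy _ (hI.mul_mem_left a hw)]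
      comp_mem := fun {y} hy i => hI.comp_mul_eq_zero_left hy i }
  have := (hprime J I hJ hI fun x hx y hy => hx y hy).resolve_right hI0
  have hx : x ∈ J := h
  rwa [this, Submodule.mem_bot] at hx

/-- The right annihilator of a nonzero ideal of a prime superalgebra is zero. -/
theorem IsPrimeSuperalgebra.eq_zero_of_mul_right (hprime : IsPrimeSuperalgebra 𝒜)
    (hI : IsSuperideal 𝒜 I) (hI0 : I ≠ ⊥) {x : A} (h : ∀ w ∈ I, w * x = 0) : x = 0 := by
  let J : Submodule R A :=
    { carrier := {x | ∀ w ∈ I, w * x = 0}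
      add_mem' := fun {a b} ha hb w hw => by rw [mul_add, ha w hw, hb w hw, add_zero]
      zero_mem' := fun w _ => mul_zero w
      smul_mem' := fun r a ha w hw => by rw [mul_smul_comm, ha w hw, smul_zero] }
  have hJ : IsSuperideal 𝒜 J :=
    { mul_mem_left := fun a y hy w hw => by rw [← mul_assoc, hy _ (hI.mul_mem_right a hw)]
      mul_mem_right := fun a y hy w hw => by rw [← mul_assoc, hy w hw, zero_mul]
      comp_mem := fun {y} hy i => hI.comp_mul_eq_zero_right hy i }
  have := (hprime I J hI hJ fun x hx y hy => hy x hx).resolve_left hI0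
  have hx : x ∈ J := h
  rwa [this, Submodule.mem_bot] at hx

/-- In a prime superalgebra `x I y = 0` with `y` homogeneous forces `x = 0` or `y = 0`. -/
theorem IsPrimeSuperalgebra.eq_zero_or_of_mul_mul (hprime : IsPrimeSuperalgebra 𝒜)
    (hI : IsSuperideal 𝒜 I) (hI0 : I ≠ ⊥) {x y : A} {i : ZMod 2} (hy : y ∈ 𝒜 i)
    (h : ∀ w ∈ I, x * w * y = 0) : x = 0 ∨ y = 0 := by
  let P : Submodule R A :=
    { carrier := {p | ∀ w ∈ I, p * w * y = 0}
      add_mem' := fun {a b} ha hb w hw => by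
        rw [add_mul, add_mul, ha w hw, hb w hw, add_zero]
      zero_mem' := fun w _ => by rw [zero_mul, zero_mul]
      smul_mem' := fun r a ha w hw => by
        rw [smul_mul_assoc, smul_mul_assoc, ha w hw, smul_zero] }
  have hP : IsSuperideal 𝒜 P :=
    { mul_mem_left := fun a p hp w hw => by
        rw [mul_assoc, mul_assoc, ← mul_assoc p, hp w hw, mul_zero]
      mul_mem_right := fun a p hp w hw => by rw [mul_assoc p, hp _ (hI.mul_mem_left a hw)]
      comp_mem := fun {p} hp k => by
        have key : ∀ j, ∀ w ∈ I, w ∈ 𝒜 j →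
            comp 𝒜 p 0 * w * y = 0 ∧ comp 𝒜 p 1 * w * y = 0 := by
          intro j w hw hj
          have e : comp 𝒜 p 0 * (w * y) + comp 𝒜 p 1 * (w * y) = 0 := by
            rw [← add_mul, comp_add_comp, ← mul_assoc, hp w hw]
          -- Homogeneity of `y` is what makes `P` graded. It cannot be dropped: in `F ⊕ Fu` with `u`
          -- odd and central, `u² = 1`, one has `(1 + u)A(1 - u) = 0`.
          have hwy : w * y ∈ 𝒜 (j + i) := SetLike.GradedMul.mul_mem hj hy
          rw [mul_assoc, mul_assoc]
          generalize j + i = k at hwy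
          fin_cases k
          · exact eq_zero_of_even_add_odd 𝒜 (even_mul_even (comp_mem_grade 𝒜 p 0) hwy)
              (odd_mul_even (comp_mem_grade 𝒜 p 1) hwy) e
          · rw [add_comm] at e
            exact (eq_zero_of_even_add_odd 𝒜 (odd_mul_odd (comp_mem_grade 𝒜 p 1) hwy)
              (even_mul_odd (comp_mem_grade 𝒜 p 0) hwy) e).symm
        intro w hw
        have k0 := key 0 _ (hI.comp_mem hw 0) (comp_mem_grade 𝒜 w 0)
        have k1 := key 1 _ (hI.comp_mem hw 1) (comp_mem_grade 𝒜 w 1)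
        rw [← comp_add_comp 𝒜 w, mul_add, add_mul]
        fin_cases k
        · exact (congrArg₂ (· + ·) k0.1 k1.1).trans (add_zero 0)
        · exact (congrArg₂ (· + ·) k0.2 k1.2).trans (add_zero 0) }
  by_cases hP0 : P = ⊥
  · left
    have hx : x ∈ P := h
    rwa [hP0, Submodule.mem_bot] at hx
  · right
    refine hprime.eq_zero_of_mul_right hI hI0 fun w hw => ?_
    refine hprime.eq_zero_of_mul_right hP hP0 fun p hp => ?_
    rw [← mul_assoc]
    exact hp w hw

theorem IsSuperideal.forall_of_homogeneous (hI : IsSuperideal 𝒜 I) {p : A → Prop}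
    (hadd : ∀ x y, p x → p y → p (x + y)) (h0 : ∀ w ∈ I, w ∈ 𝒜 0 → p w)
    (h1 : ∀ w ∈ I, w ∈ 𝒜 1 → p w) : ∀ w ∈ I, p w := by
  intro w hw
  rw [← comp_add_comp 𝒜 w]
  exact hadd _ _ (h0 _ (hI.comp_mem hw 0) (comp_mem_grade 𝒜 w 0))
    (h1 _ (hI.comp_mem hw 1) (comp_mem_grade 𝒜 w 1))

/-- An element commuting with a nonzero ideal is central. -/
theorem IsPrimeSuperalgebra.commute_of_commute_ideal (hprime : IsPrimeSuperalgebra 𝒜)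
    (hI : IsSuperideal 𝒜 I) (hI0 : I ≠ ⊥) {x : A} (h : ∀ w ∈ I, x * w = w * x) (a : A) :
    x * a = a * x := by
  rw [← sub_eq_zero]
  -- Leibniz rule: `[x, a]w = [x, aw] - a[x, w]`, and both `aw` and `w` lie in `I`.
  refine hprime.eq_zero_of_mul_left hI hI0 fun w hw => ?_
  linear_combination (norm := noncomm_ring) h _ (hI.mul_mem_left a hw) - a * h w hw

theorem IsPrimeSuperalgebra.eq_zero_or_of_central_mul (hprime : IsPrimeSuperalgebra 𝒜)
    (hI : IsSuperideal 𝒜 I) (hI0 : I ≠ ⊥) {x z : A} {i : ZMod 2} (hz : z ∈ 𝒜 i)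
    (hc : ∀ a, z * a = a * z) (h : z * x = 0) : z = 0 ∨ x = 0 := by
  refine (hprime.eq_zero_or_of_mul_mul hI hI0 (x := x) hz fun w _ => ?_).symm
  rw [← hc, ← mul_assoc, h, zero_mul]

/-- If `zx = 0` with `z` central, then `xAz = 0`. This is the cancellation law behind all divisions
by central elements below. -/
theorem IsPrimeSuperalgebra.eq_zero_of_evenCenter_mul (hprime : IsPrimeSuperalgebra 𝒜)
    {x z : A} (hz : z ∈ evenCenter 𝒜) (hz0 : z ≠ 0) (h : z * x = 0) : x = 0 := by
  have htop : IsSuperideal 𝒜 (⊤ : Submodule R A) :=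
    ⟨fun _ _ _ => trivial, fun _ _ _ => trivial, fun _ _ => trivial⟩
  refine (hprime.eq_zero_or_of_central_mul htop (fun e => hz0 ?_) hz.1 hz.2 h).resolve_left hz0
  rw [← Submodule.mem_bot R, ← e]
  trivial

theorem IsPrimeSuperalgebra.evenCenter_of_mul_mem (hprime : IsPrimeSuperalgebra 𝒜)
    {x z : A} (hz : z ∈ evenCenter 𝒜) (hz0 : z ≠ 0) (h : z * x ∈ evenCenter 𝒜) :
    x ∈ evenCenter 𝒜 := by
  constructor
  · have h1 : comp 𝒜 x 1 = 0 := by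
      refine hprime.eq_zero_of_evenCenter_mul hz hz0 ?_
      refine eq_zero_of_even_of_odd 𝒜 ?_ (even_mul_odd hz.1 (comp_mem_grade 𝒜 x 1))
      have : z * comp 𝒜 x 1 = z * x - z * comp 𝒜 x 0 := by
        rw [← mul_sub]; congr 1; exact eq_sub_of_add_eq' (comp_add_comp 𝒜 x)
      rw [this]
      exact sub_mem h.1 (even_mul_even hz.1 (comp_mem_grade 𝒜 x 0))
    rw [← comp_add_comp 𝒜 x, h1, add_zero]
    exact comp_mem_grade 𝒜 x 0
  · intro a
    rw [← sub_eq_zero]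
    refine hprime.eq_zero_of_evenCenter_mul hz hz0 ?_
    linear_combination (norm := noncomm_ring) h.2 a - hz.2 a * x

/-- For `z ∈ I₀` and `w ∈ I₁` the product `zw` is odd, so `[x, z]w = [x, zw] - z[x, w] = 0`. The
nonzero odd `v` turns an even `w` into the odd `wv`, whence `[x, z] I v = 0`. -/
theorem IsPrimeSuperalgebra.commute_of_commute_odd (hprime : IsPrimeSuperalgebra 𝒜)
    (hI : IsSuperideal 𝒜 I) (hI0 : I ≠ ⊥) {v : A} (hv1 : v ∈ 𝒜 1) (hv0 : v ≠ 0)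
    {x : A} (h : ∀ w ∈ I, w ∈ 𝒜 1 → x * w = w * x) (a : A) : x * a = a * x := by
  refine hprime.commute_of_commute_ideal hI hI0 ?_ a
  refine hI.forall_of_homogeneous (fun p q hp hq => by rw [mul_add, add_mul, hp, hq]) ?_ h
  intro z hz hz0
  rw [← sub_eq_zero]
  have hodd : ∀ w ∈ I, w ∈ 𝒜 1 → (x * z - z * x) * w = 0 := fun w hw hw1 => by
    linear_combination (norm := noncomm_ring) h _ (hI.mul_mem_left z hw) (even_mul_odd hz0 hw1)
      - z * h w hw hw1
  refine (hprime.eq_zero_or_of_mul_mul hI hI0 hv1 ?_).resolve_right hv0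
  refine hI.forall_of_homogeneous (fun p q hp hq => by rw [mul_add, add_mul, hp, hq, add_zero])
    ?_ ?_
  · intro w hw hw0
    rw [mul_assoc]
    exact hodd _ (hI.mul_mem_right v hw) (even_mul_odd hw0 hv1)
  · intro w hw hw1
    rw [hodd w hw hw1, zero_mul]

/-- A prime superalgebra with a nonzero commutative ideal is commutative. -/
theorem IsPrimeSuperalgebra.commutative_of_ideal (hprime : IsPrimeSuperalgebra 𝒜)
    (hI : IsSuperideal 𝒜 I) (hI0 : I ≠ ⊥) (h : ∀ x ∈ I, ∀ y ∈ I, x * y = y * x) (a b : A) :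
    a * b = b * a := by
  refine hprime.commute_of_commute_ideal hI hI0 (fun w hw => ?_) b
  exact (hprime.commute_of_commute_ideal hI hI0 (h w hw) a).symm

end Prime

/-! ### Gradings defined by an involution -/

section Involution

variable {F Q : Type*} [Field F] [Ring Q] [Algebra F Q]

/-- The eigenspaces of an involution `σ` for the eigenvalues `1` (degree `0`) and `-1`
(degree `1`). -/
def involutionGrading (σ : Q →ₐ[F] Q) (i : ZMod 2) : Submodule F Q where
  carrier := {q | σ q = (-1 : ℤ) ^ i.val • q}
  add_mem' := fun {a b} ha hb => by
    simp only [Set.mem_ofPred_eq] at ha hb ⊢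
    rw [map_add, ha, hb, smul_add]
  zero_mem' := by simp
  smul_mem' := fun r a ha => by
    simp only [Set.mem_ofPred_eq] at ha ⊢
    rw [map_smul, ha, smul_comm]

theorem mem_involutionGrading_zero {σ : Q →ₐ[F] Q} {q : Q} :
    q ∈ involutionGrading σ 0 ↔ σ q = q := by
  have h0 : (0 : ZMod 2).val = 0 := rfl
  change σ q = (-1 : ℤ) ^ (0 : ZMod 2).val • q ↔ _
  simp [h0]

theorem mem_involutionGrading_one {σ : Q →ₐ[F] Q} {q : Q} :
    q ∈ involutionGrading σ 1 ↔ σ q = -q := by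
  have h1 : (1 : ZMod 2).val = 1 := rfl
  change σ q = (-1 : ℤ) ^ (1 : ZMod 2).val • q ↔ _
  simp [h1]

/-- The decomposition of an element into its symmetric and skew parts. -/
noncomputable def involutionDecompose (σ : Q →ₐ[F] Q) (hσ : ∀ q, σ (σ q) = q) :
    Q →ₗ[F] DirectSum (ZMod 2) fun i => involutionGrading σ i :=
  (DirectSum.lof F (ZMod 2) (fun i => involutionGrading σ i) 0).comp
    (LinearMap.codRestrict (involutionGrading σ 0)
      ((2 : F)⁻¹ • (LinearMap.id + σ.toLinearMap)) fun q => by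
        rw [mem_involutionGrading_zero]
        simp [hσ, add_comm]) +
  (DirectSum.lof F (ZMod 2) (fun i => involutionGrading σ i) 1).comp
    (LinearMap.codRestrict (involutionGrading σ 1)
      ((2 : F)⁻¹ • (LinearMap.id - σ.toLinearMap)) fun q => by
        rw [mem_involutionGrading_one]
        simp [hσ, smul_sub])

/-- The grading by the eigenspaces of an involution. -/
@[reducible]
noncomputable def involutionGradedAlgebra (h2 : (2 : F) ≠ 0) (σ : Q →ₐ[F] Q)
    (hσ : ∀ q, σ (σ q) = q) : GradedAlgebra (involutionGrading σ) :=
  { DirectSum.Decomposition.ofLinearMap (involutionGrading σ) (involutionDecompose σ hσ)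
      (by
        ext q
        simp only [involutionDecompose, LinearMap.comp_apply, LinearMap.add_apply, map_add,
          DirectSum.coeLinearMap_lof, LinearMap.codRestrict_apply, LinearMap.smul_apply,
          LinearMap.sub_apply, LinearMap.id_apply, AlgHom.toLinearMap_apply]
        rw [← smul_add, add_add_sub_cancel, ← two_smul F q, smul_smul, inv_mul_cancel₀ h2,
          one_smul])
      (by
        ext i x : 2
        obtain ⟨x, hx⟩ := x
        simp only [involutionDecompose, LinearMap.comp_apply, LinearMap.add_apply,
          DirectSum.coeLinearMap_lof, LinearMap.id_apply]
        have hh : (2 : F)⁻¹ • (x + x) = x := by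
          rw [← two_smul F x, smul_smul, inv_mul_cancel₀ h2, one_smul]
        fin_cases i
        · have hx' := mem_involutionGrading_zero.1 hx
          have e0 : (LinearMap.codRestrict (involutionGrading σ 0)
              ((2 : F)⁻¹ • (LinearMap.id + σ.toLinearMap)) fun q => by
                rw [mem_involutionGrading_zero]
                simp [hσ, add_comm]) x = ⟨x, hx⟩ := by
            apply Subtype.ext
            simp [hx', -smul_add, hh]
          have e1 : (LinearMap.codRestrict (involutionGrading σ 1)
              ((2 : F)⁻¹ • (LinearMap.id - σ.toLinearMap)) fun q => by
                rw [mem_involutionGrading_one]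
                simp [hσ, smul_sub]) x = 0 := by
            apply Subtype.ext
            simp [hx']
          erw [e0, e1]
          simp only [map_zero, add_zero, zero_add]
          rfl
        · have hx' := mem_involutionGrading_one.1 hx
          have e0 : (LinearMap.codRestrict (involutionGrading σ 0)
              ((2 : F)⁻¹ • (LinearMap.id + σ.toLinearMap)) fun q => by
                rw [mem_involutionGrading_zero]
                simp [hσ, add_comm]) x = 0 := by
            apply Subtype.ext
            simp [hx']
          have e1 : (LinearMap.codRestrict (involutionGrading σ 1)
              ((2 : F)⁻¹ • (LinearMap.id - σ.toLinearMap)) fun q => by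
                rw [mem_involutionGrading_one]
                simp [hσ, smul_sub]) x = ⟨x, hx⟩ := by
            apply Subtype.ext
            simp [hx', -smul_add, hh]
          erw [e0, e1]
          simp only [map_zero, add_zero, zero_add]
          rfl) with
    one_mem := by rw [mem_involutionGrading_zero, map_one]
    mul_mem := fun i j a b ha hb => by
      fin_cases i <;> fin_cases j <;>
        simp only [Fin.zero_eta, Fin.mk_one, add_zero, zero_add,
          show (1 : ZMod 2) + 1 = 0 from rfl, show ((1 : Fin 2) : ZMod 2) = 1 from rfl,
          show ((0 : Fin 2) : ZMod 2) = 0 from rfl] at ha hb ⊢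
      · exact mem_involutionGrading_zero.2 (by
          rw [map_mul, mem_involutionGrading_zero.1 ha, mem_involutionGrading_zero.1 hb])
      · exact mem_involutionGrading_one.2 (by
          rw [map_mul, mem_involutionGrading_zero.1 ha, mem_involutionGrading_one.1 hb, mul_neg])
      · exact mem_involutionGrading_one.2 (by
          rw [map_mul, mem_involutionGrading_one.1 ha, mem_involutionGrading_zero.1 hb, neg_mul])
      · exact mem_involutionGrading_zero.2 (by
          rw [map_mul, mem_involutionGrading_one.1 ha, mem_involutionGrading_one.1 hb, neg_mul_neg]) }

end Involution

/-! ### Quaternion algebras: a sign involution and simplicity -/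

section Quaternion

variable {F : Type*} [Field F] {s r : F}

/-- The involution of a quaternion algebra fixing `i` and multiplying `j` by a sign `ε`. -/
def quaternionInvolution (s r ε : F) (hε : ε * ε = 1) :
    QuaternionAlgebra F s 0 r →ₐ[F] QuaternionAlgebra F s 0 r where
  toFun q := ⟨q.re, q.imI, ε * q.imJ, ε * q.imK⟩
  map_one' := by ext <;> simp
  map_mul' p q := by
    ext <;> simp
    · linear_combination (r * p.imJ * q.imJ - s * r * p.imK * q.imK) * (-hε)
    · linear_combination (r * (-p.imJ * q.imK + p.imK * q.imJ)) * (-hε)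
    · ring
    · ring
  map_zero' := by ext <;> simp
  map_add' p q := by ext <;> simp [mul_add]
  commutes' c := by ext <;> simp

/-- A quaternion algebra with nonzero structure constants has no proper nonzero ideals. -/
theorem quaternion_ideal_eq (h2 : (2 : F) ≠ 0) (hs : s ≠ 0) (hr : r ≠ 0)
    (J : Submodule F (QuaternionAlgebra F s 0 r)) (hl : ∀ a, ∀ y ∈ J, a * y ∈ J)
    (hrr : ∀ a, ∀ y ∈ J, y * a ∈ J) : J = ⊥ ∨ J = ⊤ := by
  have key : ∀ w ∈ J, w.re ≠ 0 → J = ⊤ := by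
    intro w hw h0
    let i : QuaternionAlgebra F s 0 r := ⟨0, 1, 0, 0⟩
    let j : QuaternionAlgebra F s 0 r := ⟨0, 0, 1, 0⟩
    let k : QuaternionAlgebra F s 0 r := ⟨0, 0, 0, 1⟩
    -- Up to the factor `s * r` this sums the conjugates of `w` by `1, i, j, k`: the imaginary parts
    -- cancel and the real part is multiplied by 4.
    have hmem : (s * r) • w + r • (i * w * i) + s • (j * w * j) - (k * w * k) ∈ J := by
      refine J.sub_mem (J.add_mem (J.add_mem (J.smul_mem _ hw) (J.smul_mem _ ?_))
        (J.smul_mem _ ?_)) ?_ <;> exact hrr _ _ (hl _ _ hw)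
    have he : (s * r) • w + r • (i * w * i) + s • (j * w * j) - (k * w * k) =
        (2 * 2 * s * r * w.re) • (1 : QuaternionAlgebra F s 0 r) := by
      ext <;> simp [i, j, k] <;> ring
    rw [he] at hmem
    have hne : 2 * 2 * s * r * w.re ≠ 0 := by simp [h2, hs, hr, h0]
    have h1 := J.smul_mem (2 * 2 * s * r * w.re)⁻¹ hmem
    rw [smul_smul, inv_mul_cancel₀ hne, one_smul] at h1
    rw [eq_top_iff]
    intro q _
    simpa using hl q 1 h1
  by_cases hJ : J = ⊤
  · exact Or.inr hJ
  left
  rw [eq_bot_iff]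
  intro w hw
  have hz : ∀ w ∈ J, w.re = 0 := fun w hw => by
    by_contra h
    exact hJ (key w hw h)
  have h0 := hz w hw
  -- Left multiplication by `i, j, k` moves each remaining coordinate, up to a nonzero scalar, into
  -- the real part.
  have hi := hz _ (hl ⟨0, 1, 0, 0⟩ w hw)
  have hj := hz _ (hl ⟨0, 0, 1, 0⟩ w hw)
  have hk := hz _ (hl ⟨0, 0, 0, 1⟩ w hw)
  simp [hs, hr] at hi hj hk
  rw [Submodule.mem_bot]
  ext <;> simp [h0, hi, hj, hk]

end Quaternion

/-! ### The even centroid and the fraction field of `Z` -/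

section Centroid

universe u

variable {R : Type*} {A : Type u} [CommRing R] [NonUnitalRing A] [Module R A]

/-- The ring of additive endomorphisms of degree zero commuting with all left and right
multiplications. -/
def evenCentroid (𝒜 : ZMod 2 → Submodule R A) : Subring (AddMonoid.End A) where
  carrier := {f | (∀ x y, f (x * y) = f x * y) ∧ (∀ x y, f (x * y) = x * f y) ∧
    ∀ i, ∀ x ∈ 𝒜 i, f x ∈ 𝒜 i}
  mul_mem' := fun {f _} hf hg =>
    ⟨fun x y => (congrArg f (hg.1 x y)).trans (hf.1 _ _),
      fun x y => (congrArg f (hg.2.1 x y)).trans (hf.2.1 _ _),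
      fun i x hx => hf.2.2 i _ (hg.2.2 i x hx)⟩
  one_mem' := ⟨fun _ _ => rfl, fun _ _ => rfl, fun _ _ hx => hx⟩
  add_mem' := fun hf hg =>
    ⟨fun x y => (congrArg₂ (· + ·) (hf.1 x y) (hg.1 x y)).trans (add_mul _ _ _).symm,
      fun x y => (congrArg₂ (· + ·) (hf.2.1 x y) (hg.2.1 x y)).trans (mul_add _ _ _).symm,
      fun i x hx => (𝒜 i).add_mem (hf.2.2 i x hx) (hg.2.2 i x hx)⟩
  zero_mem' := ⟨fun _ y => (zero_mul y).symm, fun x _ => (mul_zero x).symm,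
    fun i _ _ => (𝒜 i).zero_mem⟩
  neg_mem' := fun hf =>
    ⟨fun x y => (congrArg Neg.neg (hf.1 x y)).trans (neg_mul _ _).symm,
      fun x y => (congrArg Neg.neg (hf.2.1 x y)).trans (mul_neg _ _).symm,
      fun i x hx => (𝒜 i).neg_mem (hf.2.2 i x hx)⟩

variable {𝒜 : ZMod 2 → Submodule R A}

/-- Multiplication by an even central element, as an element of the centroid. -/
def evenCentroid.ofCenter [SetLike.GradedMul 𝒜] (z : A) (hz : z ∈ evenCenter 𝒜) :
    evenCentroid 𝒜 :=
  ⟨AddMonoidHom.mulLeft z, fun x y => (mul_assoc z x y).symm,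
    fun x y => by
      change z * (x * y) = x * (z * y)
      rw [← mul_assoc, hz.2, mul_assoc],
    fun i x hx => by
      have := SetLike.GradedMul.mul_mem hz.1 hx
      rwa [zero_add] at this⟩

theorem evenCentroid.map_evenCenter (f : evenCentroid 𝒜) {z : A} (hz : z ∈ evenCenter 𝒜) :
    f.1 z ∈ evenCenter 𝒜 :=
  ⟨f.2.2.2 0 z hz.1, fun a => by rw [← f.2.1, hz.2, f.2.2.1]⟩

variable [IsScalarTower R A A] [SMulCommClass R A A] [SetLike.GradedMul 𝒜]
  [DirectSum.Decomposition 𝒜]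

theorem IsSuperideal.top : IsSuperideal 𝒜 (⊤ : Submodule R A) :=
  ⟨fun _ _ _ => trivial, fun _ _ _ => trivial, fun _ _ => trivial⟩

theorem top_ne_bot_of_ne_zero (R : Type*) [CommRing R] [Module R A] {x : A} (hx : x ≠ 0) :
    (⊤ : Submodule R A) ≠ ⊥ := fun e => hx (by
  rw [← Submodule.mem_bot R, ← e]
  trivial)

/-- Both `f(g(x))w` and `g(f(x))w` equal `f(x)g(w)`, because centroid elements slide between the
factors of a product. -/
theorem evenCentroid.mul_comm (hprime : IsPrimeSuperalgebra 𝒜) (f g : evenCentroid 𝒜) :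
    f * g = g * f := by
  apply Subtype.ext
  ext x
  change f.1 (g.1 x) = g.1 (f.1 x)
  by_contra hne
  have hx : f.1 (g.1 x) - g.1 (f.1 x) ≠ 0 := sub_ne_zero.2 hne
  refine hx (hprime.eq_zero_of_mul_left IsSuperideal.top (top_ne_bot_of_ne_zero R hx)
    fun w _ => ?_)
  have h1 : f.1 (g.1 x) * w = f.1 x * g.1 w := by
    rw [← f.2.1, ← g.2.1, g.2.2.1, f.2.1]
  have h2 : g.1 (f.1 x) * w = f.1 x * g.1 w := by
    rw [← g.2.1, g.2.2.1]
  rw [sub_mul, h1, h2, sub_self]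

/-- Since `f(x) w g(y) = (fg)(xwy) = 0`, primeness applies with `y` homogeneous; degree zero of `g`
keeps `g(y)` homogeneous. -/
theorem evenCentroid.eq_zero_or_eq_zero (hprime : IsPrimeSuperalgebra 𝒜)
    (f g : evenCentroid 𝒜) (h : f * g = 0) : f = 0 ∨ g = 0 := by
  by_contra! hne
  obtain ⟨hf, hg⟩ := hne
  have hex : ∃ x, f.1 x ≠ 0 := by
    by_contra! hx
    exact hf (Subtype.ext (AddMonoidHom.ext hx))
  obtain ⟨x, hx⟩ := hex
  have hhom : ∀ i, ∀ y ∈ 𝒜 i, g.1 y = 0 := by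
    intro i y hy
    refine (hprime.eq_zero_or_of_mul_mul IsSuperideal.top (top_ne_bot_of_ne_zero R hx)
      (g.2.2.2 i y hy) fun w _ => ?_).resolve_left hx
    rw [← f.2.1, ← f.2.1, ← g.2.2.1]
    exact DFunLike.congr_fun (congrArg Subtype.val h) (x * w * y)
  refine hg (Subtype.ext (AddMonoidHom.ext ?_))
  exact forall_of_homogeneous 𝒜 (fun x y hx hy => 
    (g.1.map_add x y).trans ((congrArg₂ (· + ·) hx hy).trans (add_zero 0)))
    (hhom 0) (hhom 1)

/-- The even part of the centre of a prime superalgebra, if it is nonzero, has a field of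
fractions. -/
theorem IsPrimeSuperalgebra.exists_fraction_field (hprime : IsPrimeSuperalgebra 𝒜) {z₀ : A}
    (hz₀ : z₀ ∈ evenCenter 𝒜) (hne : z₀ ≠ 0) :
    ∃ (F : Type u) (_ : Field F) (φ : A → F),
      (∀ z ∈ evenCenter 𝒜, ∀ w ∈ evenCenter 𝒜, φ (z + w) = φ z + φ w) ∧
      (∀ z ∈ evenCenter 𝒜, ∀ w ∈ evenCenter 𝒜, φ (z * w) = φ z * φ w) ∧
      (∀ z ∈ evenCenter 𝒜, φ z = 0 → z = 0) ∧
      ∀ c : F, ∃ z ∈ evenCenter 𝒜, z ≠ 0 ∧ ∃ w ∈ evenCenter 𝒜, φ z * c = φ w := by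
  classical
  -- `A` may lack a unit, and so may `Z`. The centroid is a unital commutative domain containing
  -- `Z`, and its fraction field is already `Z⁻¹Z`.
  let : CommRing (evenCentroid 𝒜) :=
    { (inferInstance : Ring (evenCentroid 𝒜)) with mul_comm := evenCentroid.mul_comm hprime }
  have : NoZeroDivisors (evenCentroid 𝒜) :=
    ⟨fun {f g} h => evenCentroid.eq_zero_or_eq_zero hprime f g h⟩
  have hval : ∀ f g : evenCentroid 𝒜, (∀ x, f.1 x = g.1 x) → f = g := fun f g h =>
    Subtype.ext (AddMonoidHom.ext h)
  have hnt : (1 : evenCentroid 𝒜) ≠ 0 := fun h =>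
    hne (DFunLike.congr_fun (congrArg Subtype.val h) z₀)
  have : Nontrivial (evenCentroid 𝒜) := ⟨⟨1, 0, hnt⟩⟩
  have : IsDomain (evenCentroid 𝒜) := NoZeroDivisors.to_isDomain _
  have hzero : ∀ z (hz : z ∈ evenCenter 𝒜), evenCentroid.ofCenter z hz = 0 → z = 0 := by
    intro z hz h
    by_contra hz0
    have : z * z₀ = 0 := DFunLike.congr_fun (congrArg Subtype.val h) z₀
    exact hne (hprime.eq_zero_of_evenCenter_mul hz hz0 this)
  let ψ : evenCentroid 𝒜 →+* FractionRing (evenCentroid 𝒜) := algebraMap _ _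
  have hψ : Function.Injective ψ := IsFractionRing.injective _ _
  let φ : A → FractionRing (evenCentroid 𝒜) := fun z =>
    if hz : z ∈ evenCenter 𝒜 then ψ (evenCentroid.ofCenter z hz) else 0
  have hφ : ∀ z (hz : z ∈ evenCenter 𝒜), φ z = ψ (evenCentroid.ofCenter z hz) :=
    fun z hz => dif_pos hz
  refine ⟨FractionRing (evenCentroid 𝒜), inferInstance, φ, ?_, ?_, ?_, ?_⟩
  · intro z hz w hw
    rw [hφ z hz, hφ w hw, hφ _ (evenCenter.add_mem hz hw), ← map_add]
    exact congrArg ψ (hval _ _ fun x => add_mul z w x)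
  · intro z hz w hw
    rw [hφ z hz, hφ w hw, hφ _ (evenCenter.mul_mem hz hw), ← map_mul]
    exact congrArg ψ (hval _ _ fun x => mul_assoc z w x)
  · intro z hz h
    rw [hφ z hz, ← map_zero ψ] at h
    exact hzero z hz (hψ h)
  · intro c
    obtain ⟨f, g, hg, rfl⟩ := IsFractionRing.div_surjective (A := evenCentroid 𝒜) c
    have hg0 : g ≠ 0 := nonZeroDivisors.ne_zero hg
    have hgz : g.1 z₀ ≠ 0 := by
      intro h
      have : g * evenCentroid.ofCenter z₀ hz₀ = 0 := hval _ _ fun x => by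
        change g.1 (z₀ * x) = 0
        rw [g.2.1, h, zero_mul]
      rcases mul_eq_zero.1 this with h | h
      · exact hg0 h
      · exact hne (hzero _ _ h)
    -- Expanding `f / g` by `z₀` turns it into a quotient of two elements of `Z`, namely `f(z₀) /
    -- g(z₀)`.
    refine ⟨g.1 z₀, evenCentroid.map_evenCenter g hz₀, hgz, f.1 z₀, evenCentroid.map_evenCenter f hz₀, ?_⟩
    have hof : ∀ k : evenCentroid 𝒜, evenCentroid.ofCenter (k.1 z₀) (evenCentroid.map_evenCenter k hz₀) =
        k * evenCentroid.ofCenter z₀ hz₀ := fun k => hval _ _ fun x => (k.2.1 z₀ x).symm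
    have hψg : ψ g ≠ 0 := fun h => hg0 (hψ (h.trans (map_zero ψ).symm))
    rw [hφ _ (evenCentroid.map_evenCenter g hz₀), hφ _ (evenCentroid.map_evenCenter f hz₀), hof, hof, map_mul, map_mul]
    change ψ g * ψ _ * (ψ f / ψ g) = _
    field_simp

end Centroid

set_option linter.unusedSimpArgs false

/-! ### Coordinates with respect to `1, a, b, ab` -/

section QuaternionCoordinates

universe u

variable {R : Type*} {A : Type u} [CommRing R] [NonUnitalRing A] [Module R A]
  {𝒜 : ZMod 2 → Submodule R A} {a b s r : A}

/-- With the next lemma, a denominator-free form of the projections of `x` to the elements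
commuting, respectively anticommuting, with `a`: formally these are `(x ± a⁻¹xa)/2` scaled by `2a²`.
-/
theorem mul_symmetrize (hs : ∀ x, a * a * x = x * (a * a)) (x : A) :
    a * (a * a * x + a * x * a) = (a * a * x + a * x * a) * a := by
  linear_combination (norm := noncomm_ring) a * hs x

theorem mul_antisymmetrize (hs : ∀ x, a * a * x = x * (a * a)) (x : A) :
    a * (a * a * x - a * x * a) = -((a * a * x - a * x * a) * a) := by
  linear_combination (norm := noncomm_ring) a * hs x

/-- If the centralizer of two anticommuting elements `a`, `b` with central squares consists of
even central elements, every element is a combination of `1`, `a`, `b`, `a * b` up to a central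
factor. -/
theorem exists_coordinates [SetLike.GradedMul 𝒜] (hab : a * b = -(b * a))
    (hs : a * a ∈ evenCenter 𝒜) (hr : b * b ∈ evenCenter 𝒜)
    (hC : ∀ x, a * x = x * a → b * x = x * b → x ∈ evenCenter 𝒜) (x : A) :
    ∃ z₀ ∈ evenCenter 𝒜, ∃ z₁ ∈ evenCenter 𝒜, ∃ z₂ ∈ evenCenter 𝒜, ∃ z₃ ∈ evenCenter 𝒜,
      4 • (a * a * (b * b) * (a * a * (b * b))) * x = z₀ + z₁ * a + z₂ * b + z₃ * (a * b) := by
  obtain ⟨x₁, hx₁⟩ : ∃ t, t = a * a * x + a * x * a := ⟨_, rfl⟩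
  obtain ⟨x₂, hx₂⟩ : ∃ t, t = a * a * x - a * x * a := ⟨_, rfl⟩
  have c1 : a * x₁ = x₁ * a := hx₁ ▸ mul_symmetrize hs.2 x
  have c2 : a * x₂ = -(x₂ * a) := hx₂ ▸ mul_antisymmetrize hs.2 x
  -- The four parts of `x` under the two commuting conjugations by `a` and `b`, one for each pair of
  -- signs.
  obtain ⟨y₀, hy₀⟩ : ∃ t, t = b * b * x₁ + b * x₁ * b := ⟨_, rfl⟩
  obtain ⟨y₁, hy₁⟩ : ∃ t, t = b * b * x₁ - b * x₁ * b := ⟨_, rfl⟩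
  obtain ⟨y₂, hy₂⟩ : ∃ t, t = b * b * x₂ + b * x₂ * b := ⟨_, rfl⟩
  obtain ⟨y₃, hy₃⟩ : ∃ t, t = b * b * x₂ - b * x₂ * b := ⟨_, rfl⟩
  have b0 : b * y₀ = y₀ * b := hy₀ ▸ mul_symmetrize hr.2 x₁
  have b1 : b * y₁ = -(y₁ * b) := hy₁ ▸ mul_antisymmetrize hr.2 x₁
  have b2 : b * y₂ = y₂ * b := hy₂ ▸ mul_symmetrize hr.2 x₂
  have b3 : b * y₃ = -(y₃ * b) := hy₃ ▸ mul_antisymmetrize hr.2 x₂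
  have d1 : a * (b * x₁ * b) = b * x₁ * b * a := by
    linear_combination (norm := noncomm_ring) hab * x₁ * b - b * c1 * b - b * x₁ * hab
  have d2 : a * (b * x₂ * b) = -(b * x₂ * b * a) := by
    linear_combination (norm := noncomm_ring) hab * x₂ * b - b * c2 * b + b * x₂ * hab
  have a0 : a * y₀ = y₀ * a := by
    rw [hy₀]
    linear_combination (norm := noncomm_ring) d1 - hr.2 a * x₁ + b * b * c1
  have a1 : a * y₁ = y₁ * a := by
    rw [hy₁]
    linear_combination (norm := noncomm_ring) -d1 - hr.2 a * x₁ + b * b * c1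
  have a2 : a * y₂ = -(y₂ * a) := by
    rw [hy₂]
    linear_combination (norm := noncomm_ring) d2 - hr.2 a * x₂ + b * b * c2
  have a3 : a * y₃ = -(y₃ * a) := by
    rw [hy₃]
    linear_combination (norm := noncomm_ring) -d2 - hr.2 a * x₂ + b * b * c2
  -- Multiplication by `1, a, b, ab` respectively corrects the signs, so each product centralizes
  -- both `a` and `b`.
  have z0 : y₀ ∈ evenCenter 𝒜 := hC _ a0 b0
  have z1 : a * y₁ ∈ evenCenter 𝒜 := by
    refine hC _ ?_ ?_
    · linear_combination (norm := noncomm_ring) a * a1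
    · linear_combination (norm := noncomm_ring) hab * y₁ - a * b1
  have z2 : b * y₂ ∈ evenCenter 𝒜 := by
    refine hC _ ?_ ?_
    · linear_combination (norm := noncomm_ring) hab * y₂ - b * a2
    · linear_combination (norm := noncomm_ring) b * b2
  have z3 : a * b * y₃ ∈ evenCenter 𝒜 := by
    refine hC _ ?_ ?_
    · linear_combination (norm := noncomm_ring) a * hab * y₃ - a * b * a3
    · linear_combination (norm := noncomm_ring) hab * b * y₃ - a * b * b3
  refine ⟨_, evenCenter.mul_mem (evenCenter.mul_mem hs hr) z0, _, evenCenter.mul_mem hr z1, _,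
    evenCenter.mul_mem hs z2, _, evenCenter.neg_mem z3, ?_⟩
  have e : 4 • (a * a * (b * b)) * x = y₀ + y₁ + y₂ + y₃ := by
    have e1 : x₁ + x₂ = 2 • (a * a * x) := by rw [hx₁, hx₂]; noncomm_ring
    have e2 : y₀ + y₁ = 2 • (b * b * x₁) := by rw [hy₀, hy₁]; noncomm_ring
    have e3 : y₂ + y₃ = 2 • (b * b * x₂) := by rw [hy₂, hy₃]; noncomm_ring
    linear_combination (norm := noncomm_ring) -e2 - e3 - 2 • (b * b * e1) -
      4 • (hr.2 (a * a) * x)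
  have f1 : a * y₁ * a = a * a * y₁ := by linear_combination (norm := noncomm_ring) -(a * a1)
  have f2 : b * y₂ * b = b * b * y₂ := by linear_combination (norm := noncomm_ring) -(b * b2)
  have f3 : a * b * y₃ * (a * b) = - (a * a * (b * b) * y₃) := by
    linear_combination (norm := noncomm_ring) a * b * a3 * b - a * b * a * b3 + a * hab * b * y₃
  linear_combination (norm := noncomm_ring) a * a * (b * b) * e - b * b * f1 - a * a * f2 + f3
    - hr.2 (a * a) * y₁

variable [IsScalarTower R A A] [SMulCommClass R A A] [SetLike.GradedMul 𝒜]
  [DirectSum.Decomposition 𝒜]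

/-- Sandwiching by `b` changes the sign of `a`, so `b²(z + wa) + b(z + wa)b = 2b²z`. -/
theorem eq_zero_of_center_add_mul (h2 : IsUnit (2 : R)) (hprime : IsPrimeSuperalgebra 𝒜)
    (hab : a * b = -(b * a)) (hs0 : a * a ≠ 0) (hr : b * b ∈ evenCenter 𝒜) (hr0 : b * b ≠ 0)
    {z w : A} (hz : z ∈ evenCenter 𝒜) (hw : w ∈ evenCenter 𝒜) (h : z + w * a = 0) :
    z = 0 ∧ w = 0 := by
  have hz0 : z = 0 := by
    refine hprime.eq_zero_of_evenCenter_mul hr hr0 (eq_zero_of_add_self h2 ?_)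
    linear_combination (norm := noncomm_ring) b * b * h + b * h * b - b * hz.2 b -
      b * b * hw.2 a - b * hw.2 (a * b) - b * hab * w
  refine ⟨hz0, ?_⟩
  by_contra hw0
  rw [hz0, zero_add] at h
  exact hs0 (by rw [hprime.eq_zero_of_evenCenter_mul hw hw0 h, zero_mul])

/-- Coordinates with respect to `1`, `a`, `b`, `a * b` are unique. -/
theorem coordinates_eq_zero (h2 : IsUnit (2 : R)) (hprime : IsPrimeSuperalgebra 𝒜)
    (hab : a * b = -(b * a)) (hs : a * a ∈ evenCenter 𝒜) (hs0 : a * a ≠ 0)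
    (hr : b * b ∈ evenCenter 𝒜) (hr0 : b * b ≠ 0)
    {z₀ z₁ z₂ z₃ : A} (h₀ : z₀ ∈ evenCenter 𝒜) (h₁ : z₁ ∈ evenCenter 𝒜)
    (h₂ : z₂ ∈ evenCenter 𝒜) (h₃ : z₃ ∈ evenCenter 𝒜)
    (h : z₀ + z₁ * a + z₂ * b + z₃ * (a * b) = 0) :
    z₀ = 0 ∧ z₁ = 0 ∧ z₂ = 0 ∧ z₃ = 0 := by
  -- Sandwiching the relation by `a` changes the sign of its `b` and `ab` terms; adding `a²` times
  -- the relation isolates `2a²(z₀ + z₁a)`.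
  have e1 : z₀ + z₁ * a = 0 := by
    refine hprime.eq_zero_of_evenCenter_mul hs hs0 (eq_zero_of_add_self h2 ?_)
    linear_combination (norm := noncomm_ring) a * a * h + a * h * a - a * h₀.2 a -
      a * h₁.2 a * a - a * a * h₂.2 b - a * h₂.2 (b * a) - a * hab * z₂
      - a * a * h₃.2 (a * b) - a * h₃.2 (a * b * a) - a * a * hab * z₃
  obtain ⟨k0, k1⟩ := eq_zero_of_center_add_mul h2 hprime hab hs0 hr hr0 h₀ h₁ e1
  have e2 : z₂ + z₃ * a = 0 := by
    refine hprime.eq_zero_of_evenCenter_mul hr hr0 ?_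
    rw [k0, k1] at h
    linear_combination (norm := noncomm_ring) h * b + hr.2 (z₂ + z₃ * a)
  obtain ⟨k2, k3⟩ := eq_zero_of_center_add_mul h2 hprime hab hs0 hr hr0 h₂ h₃ e2
  exact ⟨k0, k1, k2, k3⟩

/-- This is the multiplication table of `QuaternionAlgebra`, used to prove that the coordinate map
is multiplicative. Only the second factor needs central coordinates, since those of the first
already stand on the left. -/
theorem coordinates_mul (hab : a * b = -(b * a)) (ha : a * a = s) (hb : b * b = r)
    (hs : ∀ x, x * s = s * x) (hr : ∀ x, x * r = r * x) {y₀ y₁ y₂ y₃ : A}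
    (hy₀ : ∀ x, x * y₀ = y₀ * x) (hy₁ : ∀ x, x * y₁ = y₁ * x)
    (hy₂ : ∀ x, x * y₂ = y₂ * x) (hy₃ : ∀ x, x * y₃ = y₃ * x) (x₀ x₁ x₂ x₃ : A) :
    (x₀ + x₁ * a + x₂ * b + x₃ * (a * b)) * (y₀ + y₁ * a + y₂ * b + y₃ * (a * b)) =
      (x₀ * y₀ + s * (x₁ * y₁) + r * (x₂ * y₂) - s * r * (x₃ * y₃)) +
      (x₀ * y₁ + x₁ * y₀ - r * (x₂ * y₃) + r * (x₃ * y₂)) * a +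
      (x₀ * y₂ + x₂ * y₀ + s * (x₁ * y₃) - s * (x₃ * y₁)) * b +
      (x₀ * y₃ + x₃ * y₀ + x₁ * y₂ - x₂ * y₁) * (a * b) := by
  have hba : b * a = -(a * b) := by rw [hab, neg_neg]
  have hba' : ∀ t, b * (a * t) = -(a * (b * t)) := fun t => by
    rw [← mul_assoc, hba, neg_mul, mul_assoc]
  have haa : ∀ t, a * (a * t) = s * t := fun t => by rw [← ha, mul_assoc]
  have hbb : ∀ t, b * (b * t) = r * t := fun t => by rw [← hb, mul_assoc]
  have c : ∀ {z : A}, (∀ x, x * z = z * x) → ∀ p t, p * (z * t) = z * (p * t) :=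
    fun hz p t => by rw [← mul_assoc, hz, mul_assoc]
  simp only [mul_add, add_mul, sub_mul, mul_assoc, c hy₀ a, c hy₁ a, c hy₂ a, c hy₃ a,
    c hy₀ b, c hy₁ b, c hy₂ b, c hy₃ b, hy₀ a, hy₁ a, hy₂ a, hy₃ a, hy₀ b,
    hy₁ b, hy₂ b, hy₃ b, hba, hba', haa, hbb, ha, hb, mul_neg,
    c hs x₀, c hs x₁, c hs x₂, c hs x₃, c hs y₀, c hs y₁, c hs y₂, c hs y₃, c hs r, hs r,
    c hr x₀, c hr x₁, c hr x₂, c hr x₃, c hr y₀, c hr y₁, c hr y₂, c hr y₃, c hs a, c hs b,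
    c hr a, c hr b, hs x₀, hs x₁, hs x₂, hs x₃, hs y₀, hs y₁, hs y₂, hs y₃, hs a, hs b,
    hr x₀, hr x₁, hr x₂, hr x₃, hr y₀, hr y₁, hr y₂, hr y₃, hr a, hr b]
  abel

end QuaternionCoordinates

/-! ### The quaternion criterion -/

section Criterion

universe u

variable {R : Type*} {A : Type u} [CommRing R] [NonUnitalRing A] [Module R A]
  [IsScalarTower R A A] [SMulCommClass R A A]
  {𝒜 : ZMod 2 → Submodule R A} [SetLike.GradedMul 𝒜] [DirectSum.Decomposition 𝒜] {a b : A}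

/-- If `a`, `b` are anticommuting homogeneous elements, `a` even, whose squares are nonzero and
lie in `Z`, and if the centralizer of `a` and `b` is contained in `Z`, then `A` is a central order
in a quaternion algebra. -/
theorem IsPrimeSuperalgebra.isCentralOrderInSimple (h2 : IsUnit (2 : R))
    (hprime : IsPrimeSuperalgebra 𝒜) (ha : a ∈ 𝒜 0) {j : ZMod 2} (hb : b ∈ 𝒜 j)
    (hab : a * b = -(b * a)) (hs : a * a ∈ evenCenter 𝒜) (hs0 : a * a ≠ 0)
    (hr : b * b ∈ evenCenter 𝒜) (hr0 : b * b ≠ 0)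
    (hC : ∀ x, a * x = x * a → b * x = x * b → x ∈ evenCenter 𝒜) :
    IsCentralOrderInSimple 𝒜 4 := by
  obtain ⟨F, hF, φ, φadd, φmul, φinj, φfrac⟩ := hprime.exists_fraction_field hs hs0
  -- The uniform denominator supplied by `exists_coordinates`, the same for every `x`.
  obtain ⟨K, hK⟩ : ∃ K, K = 4 • (a * a * (b * b) * (a * a * (b * b))) := ⟨_, rfl⟩
  have hcancel : ∀ {z x : A}, z ∈ evenCenter 𝒜 → z ≠ 0 → z * x = 0 → x = 0 :=
    fun hz hz0 h => hprime.eq_zero_of_evenCenter_mul hz hz0 h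
  have hsr : a * a * (b * b) ∈ evenCenter 𝒜 := evenCenter.mul_mem hs hr
  have hsr0 : a * a * (b * b) ≠ 0 := fun h => hr0 (hcancel hs hs0 h)
  have hKmem : K ∈ evenCenter 𝒜 := by
    have h := evenCenter.mul_mem hsr hsr
    rw [hK, show (4 : ℕ) = 2 * 2 from rfl, mul_smul, two_smul, two_smul]
    exact evenCenter.add_mem (evenCenter.add_mem h h) (evenCenter.add_mem h h)
  have hK0 : K ≠ 0 := by
    intro h
    rw [hK, show (4 : ℕ) = 2 * 2 from rfl, mul_smul, two_smul] at h
    have h' := eq_zero_of_add_self h2 h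
    rw [two_smul] at h'
    exact hsr0 (hcancel hsr hsr0 (eq_zero_of_add_self h2 h'))
  have hzero : (0 : A) ∈ evenCenter 𝒜 := evenCenter.zero_mem
  have φ0 : φ 0 = 0 := by
    have := φadd 0 hzero 0 hzero
    rw [add_zero] at this
    simpa using this
  have φneg : ∀ z ∈ evenCenter 𝒜, φ (-z) = -φ z := fun z hz => by
    have := φadd z hz (-z) (evenCenter.neg_mem hz)
    rw [add_neg_cancel, φ0] at this
    exact eq_neg_of_add_eq_zero_right this.symm
  have φsub : ∀ z ∈ evenCenter 𝒜, ∀ w ∈ evenCenter 𝒜, φ (z - w) = φ z - φ w :=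
    fun z hz w hw => by
      rw [sub_eq_add_neg, φadd z hz _ (evenCenter.neg_mem hw), φneg w hw, sub_eq_add_neg]
  have φne : ∀ z ∈ evenCenter 𝒜, z ≠ 0 → φ z ≠ 0 := fun z hz h0 h => h0 (φinj z hz h)
  have hF2 : (2 : F) ≠ 0 := by
    intro h
    have := φadd K hKmem K hKmem
    rw [← two_mul, h, zero_mul] at this
    exact hK0 (eq_zero_of_add_self h2 (φinj _ (evenCenter.add_mem hKmem hKmem) this))
  choose c₀ m₀ c₁ m₁ c₂ m₂ c₃ m₃ hc using exists_coordinates hab hs hr hC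
  rw [← hK] at hc
  have huniq : ∀ {z₀ z₁ z₂ z₃ w₀ w₁ w₂ w₃ : A}, z₀ ∈ evenCenter 𝒜 → z₁ ∈ evenCenter 𝒜 →
      z₂ ∈ evenCenter 𝒜 → z₃ ∈ evenCenter 𝒜 → w₀ ∈ evenCenter 𝒜 → w₁ ∈ evenCenter 𝒜 →
      w₂ ∈ evenCenter 𝒜 → w₃ ∈ evenCenter 𝒜 →
      z₀ + z₁ * a + z₂ * b + z₃ * (a * b) = w₀ + w₁ * a + w₂ * b + w₃ * (a * b) →
      z₀ = w₀ ∧ z₁ = w₁ ∧ z₂ = w₂ ∧ z₃ = w₃ := by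
    intro z₀ z₁ z₂ z₃ w₀ w₁ w₂ w₃ h0 h1 h2' h3 k0 k1 k2 k3 h
    obtain ⟨e0, e1, e2, e3⟩ := coordinates_eq_zero h2 hprime hab hs hs0 hr hr0
      (evenCenter.sub_mem h0 k0) (evenCenter.sub_mem h1 k1) (evenCenter.sub_mem h2' k2)
      (evenCenter.sub_mem h3 k3) (by linear_combination (norm := noncomm_ring) h)
    exact ⟨sub_eq_zero.1 e0, sub_eq_zero.1 e1, sub_eq_zero.1 e2, sub_eq_zero.1 e3⟩
  let f : A → QuaternionAlgebra F (φ (a * a)) 0 (φ (b * b)) := fun x =>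
    ⟨(φ K)⁻¹ * φ (c₀ x), (φ K)⁻¹ * φ (c₁ x), (φ K)⁻¹ * φ (c₂ x), (φ K)⁻¹ * φ (c₃ x)⟩
  have hφK : φ K ≠ 0 := φne K hKmem hK0
  -- By uniqueness of coordinates, `f x` can be read off from any representation with any nonzero
  -- central denominator; additivity and multiplicativity follow from this.
  have hf : ∀ {z x w₀ w₁ w₂ w₃ : A}, z ∈ evenCenter 𝒜 → z ≠ 0 → w₀ ∈ evenCenter 𝒜 →
      w₁ ∈ evenCenter 𝒜 → w₂ ∈ evenCenter 𝒜 → w₃ ∈ evenCenter 𝒜 →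
      z * x = w₀ + w₁ * a + w₂ * b + w₃ * (a * b) →
      f x = ⟨(φ z)⁻¹ * φ w₀, (φ z)⁻¹ * φ w₁, (φ z)⁻¹ * φ w₂, (φ z)⁻¹ * φ w₃⟩ := by
    intro z x w₀ w₁ w₂ w₃ hz hz0 h0 h1 h2' h3 h
    have hφz := φne z hz hz0
    obtain ⟨e0, e1, e2, e3⟩ := huniq (evenCenter.mul_mem hz (m₀ x)) (evenCenter.mul_mem hz (m₁ x))
      (evenCenter.mul_mem hz (m₂ x)) (evenCenter.mul_mem hz (m₃ x)) (evenCenter.mul_mem hKmem h0)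
      (evenCenter.mul_mem hKmem h1) (evenCenter.mul_mem hKmem h2') (evenCenter.mul_mem hKmem h3)
      (by linear_combination (norm := noncomm_ring) -z * hc x + K * h + hz.2 K * x)
    have key : ∀ {p q : A}, p ∈ evenCenter 𝒜 → q ∈ evenCenter 𝒜 → z * p = K * q →
        (φ K)⁻¹ * φ p = (φ z)⁻¹ * φ q := by
      intro p q hp hq hpq
      have := congrArg φ hpq
      rw [φmul z hz p hp, φmul K hKmem q hq] at this
      field_simp
      linear_combination this
    simp only [f, key (m₀ x) h0 e0, key (m₁ x) h1 e1, key (m₂ x) h2' e2, key (m₃ x) h3 e3]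
  have hf0 : f 0 = 0 := by
    rw [hf hKmem hK0 hzero hzero hzero hzero (x := 0) (by simp)]
    ext <;> simp [φ0]
  have hfadd : ∀ x y, f (x + y) = f x + f y := by
    intro x y
    rw [hf hKmem hK0 (evenCenter.add_mem (m₀ x) (m₀ y)) (evenCenter.add_mem (m₁ x) (m₁ y))
      (evenCenter.add_mem (m₂ x) (m₂ y)) (evenCenter.add_mem (m₃ x) (m₃ y)) (x := x + y)
      (by linear_combination (norm := noncomm_ring) hc x + hc y)]
    ext <;> simp [f, φadd _ (m₀ x) _ (m₀ y), φadd _ (m₁ x) _ (m₁ y), φadd _ (m₂ x) _ (m₂ y),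
      φadd _ (m₃ x) _ (m₃ y), mul_add]
  have hfmul : ∀ x y, f (x * y) = f x * f y := by
    intro x y
    have M := fun {p q : A} (hp : p ∈ evenCenter 𝒜) (hq : q ∈ evenCenter 𝒜) =>
      evenCenter.mul_mem hp hq
    have P := fun {p q : A} (hp : p ∈ evenCenter 𝒜) (hq : q ∈ evenCenter 𝒜) =>
      evenCenter.add_mem hp hq
    have S := fun {p q : A} (hp : p ∈ evenCenter 𝒜) (hq : q ∈ evenCenter 𝒜) =>
      evenCenter.sub_mem hp hq
    have t₀ := S (P (P (M (m₀ x) (m₀ y)) (M hs (M (m₁ x) (m₁ y)))) (M hr (M (m₂ x) (m₂ y))))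
      (M hsr (M (m₃ x) (m₃ y)))
    have t₁ := P (S (P (M (m₀ x) (m₁ y)) (M (m₁ x) (m₀ y))) (M hr (M (m₂ x) (m₃ y))))
      (M hr (M (m₃ x) (m₂ y)))
    have t₂ := S (P (P (M (m₀ x) (m₂ y)) (M (m₂ x) (m₀ y))) (M hs (M (m₁ x) (m₃ y))))
      (M hs (M (m₃ x) (m₁ y)))
    have t₃ := S (P (P (M (m₀ x) (m₃ y)) (M (m₃ x) (m₀ y))) (M (m₁ x) (m₂ y)))
      (M (m₂ x) (m₁ y))
    have hKK : K * K ≠ 0 := fun h => hK0 (hcancel hKmem hK0 h)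
    have hK2 : K * K * (x * y) = K * x * (K * y) := by
      linear_combination (norm := noncomm_ring) K * hKmem.2 x * y
    rw [hc x, hc y, coordinates_mul hab rfl rfl (fun t => (hs.2 t).symm) (fun t => (hr.2 t).symm)
      (fun t => ((m₀ y).2 t).symm) (fun t => ((m₁ y).2 t).symm) (fun t => ((m₂ y).2 t).symm)
      (fun t => ((m₃ y).2 t).symm)] at hK2
    rw [hf (M hKmem hKmem) hKK t₀ t₁ t₂ t₃ hK2]
    ext <;> simp only [f, QuaternionAlgebra.re_mul, QuaternionAlgebra.imI_mul,
      QuaternionAlgebra.imJ_mul, QuaternionAlgebra.imK_mul, φmul K hKmem K hKmem]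
    · rw [φsub _ (P (P (M (m₀ x) (m₀ y)) (M hs (M (m₁ x) (m₁ y)))) (M hr (M (m₂ x) (m₂ y)))) _
        (M hsr (M (m₃ x) (m₃ y))), φadd _ (P (M (m₀ x) (m₀ y)) (M hs (M (m₁ x) (m₁ y)))) _
        (M hr (M (m₂ x) (m₂ y))), φadd _ (M (m₀ x) (m₀ y)) _ (M hs (M (m₁ x) (m₁ y))),
        φmul _ (m₀ x) _ (m₀ y), φmul _ hs _ (M (m₁ x) (m₁ y)), φmul _ (m₁ x) _ (m₁ y),
        φmul _ hr _ (M (m₂ x) (m₂ y)), φmul _ (m₂ x) _ (m₂ y), φmul _ hsr _ (M (m₃ x) (m₃ y)),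
        φmul _ (m₃ x) _ (m₃ y), φmul _ hs _ hr]
      field_simp
      ring
    · rw [φadd _ (S (P (M (m₀ x) (m₁ y)) (M (m₁ x) (m₀ y))) (M hr (M (m₂ x) (m₃ y)))) _
        (M hr (M (m₃ x) (m₂ y))), φsub _ (P (M (m₀ x) (m₁ y)) (M (m₁ x) (m₀ y))) _
        (M hr (M (m₂ x) (m₃ y))), φadd _ (M (m₀ x) (m₁ y)) _ (M (m₁ x) (m₀ y)),
        φmul _ (m₀ x) _ (m₁ y), φmul _ (m₁ x) _ (m₀ y), φmul _ hr _ (M (m₂ x) (m₃ y)),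
        φmul _ (m₂ x) _ (m₃ y), φmul _ hr _ (M (m₃ x) (m₂ y)), φmul _ (m₃ x) _ (m₂ y)]
      field_simp
      ring
    · rw [φsub _ (P (P (M (m₀ x) (m₂ y)) (M (m₂ x) (m₀ y))) (M hs (M (m₁ x) (m₃ y)))) _
        (M hs (M (m₃ x) (m₁ y))), φadd _ (P (M (m₀ x) (m₂ y)) (M (m₂ x) (m₀ y))) _
        (M hs (M (m₁ x) (m₃ y))), φadd _ (M (m₀ x) (m₂ y)) _ (M (m₂ x) (m₀ y)),
        φmul _ (m₀ x) _ (m₂ y), φmul _ (m₂ x) _ (m₀ y), φmul _ hs _ (M (m₁ x) (m₃ y)),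
        φmul _ (m₁ x) _ (m₃ y), φmul _ hs _ (M (m₃ x) (m₁ y)), φmul _ (m₃ x) _ (m₁ y)]
      field_simp
      ring
    · rw [φsub _ (P (P (M (m₀ x) (m₃ y)) (M (m₃ x) (m₀ y))) (M (m₁ x) (m₂ y))) _
        (M (m₂ x) (m₁ y)), φadd _ (P (M (m₀ x) (m₃ y)) (M (m₃ x) (m₀ y))) _
        (M (m₁ x) (m₂ y)), φadd _ (M (m₀ x) (m₃ y)) _ (M (m₃ x) (m₀ y)),
        φmul _ (m₀ x) _ (m₃ y), φmul _ (m₃ x) _ (m₀ y), φmul _ (m₁ x) _ (m₂ y),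
        φmul _ (m₂ x) _ (m₁ y)]
      field_simp
      ring
  have hfZ : ∀ z ∈ evenCenter 𝒜, f z = algebraMap F _ (φ z) := by
    intro z hz
    rw [hf hKmem hK0 (evenCenter.mul_mem hKmem hz) hzero hzero hzero (x := z) (by simp)]
    ext <;> simp [φmul K hKmem z hz, φ0, hφK]
  let ι : A →ₙ+* QuaternionAlgebra F (φ (a * a)) 0 (φ (b * b)) :=
    { toFun := f, map_mul' := hfmul, map_zero' := hf0, map_add' := hfadd }
  -- The sign is the parity of `b`: as `a` is even, multiplying the `b` and `ab` coordinates by `ε`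
  -- is the parity involution of the quaternion algebra.
  obtain ⟨ε, hε, hε0, hε1⟩ : ∃ ε : F, ε * ε = 1 ∧ (j = 0 → ε = 1) ∧ (j = 1 → ε = -1) := by
    by_cases h : j = 0
    · exact ⟨1, by simp, fun _ => rfl, fun h' => absurd (h.symm.trans h') (by decide)⟩
    · exact ⟨-1, by simp, fun h' => absurd h' h, fun _ => rfl⟩
  let σ := quaternionInvolution (φ (a * a)) (φ (b * b)) ε hε
  have hσ : ∀ q, σ (σ q) = q := by
    intro q
    ext <;> simp only [σ, quaternionInvolution, AlgHom.coe_mk, RingHom.coe_mk, MonoidHom.coe_mk,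
      OneHom.coe_mk, ← mul_assoc, hε, one_mul]
  have hιmem : ∀ (i : ZMod 2) {x : A}, x ∈ 𝒜 i → ι x ∈ involutionGrading σ i := by
    intro i x hx
    have hsplit : ∀ {p q : A}, p ∈ 𝒜 0 → q ∈ 𝒜 1 → p = q → p = 0 ∧ q = 0 := by
      intro p q hp hq h
      have := eq_zero_of_even_of_odd 𝒜 hp (h ▸ hq)
      exact ⟨this, h ▸ this⟩
    have e0 := even_mul_even (m₁ x).1 ha
    have hdich : ∀ k : ZMod 2, k = 0 ∨ k = 1 := by decide
    rcases hdich j with rfl | rfl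
    · have hev : K * x ∈ 𝒜 0 := by
        rw [hc x]
        exact add_mem (add_mem (add_mem (m₀ x).1 e0) (even_mul_even (m₂ x).1 hb))
          (even_mul_even (m₃ x).1 (even_mul_even ha hb))
      rcases hdich i with rfl | rfl
      · rw [mem_involutionGrading_zero]
        ext <;> simp [σ, quaternionInvolution, hε0 rfl]
      · have hx0 : x = 0 := hcancel hKmem hK0
          (eq_zero_of_even_of_odd 𝒜 hev (even_mul_odd hKmem.1 hx))
        rw [hx0, map_zero]
        exact zero_mem _
    · have o2 := even_mul_odd (m₂ x).1 hb
      have o3 := even_mul_odd (m₃ x).1 (even_mul_odd ha hb)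
      rcases hdich i with rfl | rfl
      · obtain ⟨h0, -⟩ := hsplit
          (sub_mem (even_mul_even hKmem.1 hx) (add_mem (m₀ x).1 e0)) (add_mem o2 o3)
          (by rw [hc x]; abel)
        rw [mem_involutionGrading_zero]
        have e : f x = _ := hf hKmem hK0 (m₀ x) (m₁ x) hzero hzero (x := x)
          (by linear_combination (norm := noncomm_ring) h0)
        change σ (f x) = f x
        rw [e]
        ext <;> simp [σ, quaternionInvolution, φ0]
      · obtain ⟨-, h0⟩ := hsplit (add_mem (m₀ x).1 e0)
          (sub_mem (even_mul_odd hKmem.1 hx) (add_mem o2 o3)) (by rw [hc x]; abel)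
        rw [mem_involutionGrading_one]
        have e : f x = _ := hf hKmem hK0 hzero hzero (m₂ x) (m₃ x) (x := x)
          (by linear_combination (norm := noncomm_ring) h0)
        change σ (f x) = -f x
        rw [e]
        ext <;> simp [σ, quaternionInvolution, φ0, hε1 rfl]
  let hgr : GradedAlgebra (involutionGrading σ) := involutionGradedAlgebra hF2 σ hσ
  refine ⟨F, QuaternionAlgebra F (φ (a * a)) 0 (φ (b * b)), hF, inferInstance, inferInstance,
    involutionGrading σ, hgr, ι, ⟨?_, hιmem, ?_, ?_, ?_⟩, ⟨?_, ?_⟩,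
    inferInstance, QuaternionAlgebra.finrank_eq_four _ _ _⟩
  · rw [injective_iff_map_eq_zero]
    intro x hx
    have hx' : f x = 0 := hx
    have q0 : φ (c₀ x) = 0 := by simpa [f, hφK] using congrArg QuaternionAlgebra.re hx'
    have q1 : φ (c₁ x) = 0 := by simpa [f, hφK] using congrArg QuaternionAlgebra.imI hx'
    have q2 : φ (c₂ x) = 0 := by simpa [f, hφK] using congrArg QuaternionAlgebra.imJ hx'
    have q3 : φ (c₃ x) = 0 := by simpa [f, hφK] using congrArg QuaternionAlgebra.imK hx'
    refine hcancel hKmem hK0 ?_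
    rw [hc x, φinj _ (m₀ x) q0, φinj _ (m₁ x) q1, φinj _ (m₂ x) q2, φinj _ (m₃ x) q3]
    simp
  · exact fun z hz => ⟨φ z, hfZ z hz⟩
  · intro q
    obtain ⟨z₀, hz₀, n₀, w₀, hw₀, k₀⟩ := φfrac q.re
    obtain ⟨z₁, hz₁, n₁, w₁, hw₁, k₁⟩ := φfrac q.imI
    obtain ⟨z₂, hz₂, n₂, w₂, hw₂, k₂⟩ := φfrac q.imJ
    obtain ⟨z₃, hz₃, n₃, w₃, hw₃, k₃⟩ := φfrac q.imK
    have M := fun {p q : A} (hp : p ∈ evenCenter 𝒜) (hq : q ∈ evenCenter 𝒜) =>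
      evenCenter.mul_mem hp hq
    have N := fun {p q : A} (hp : p ∈ evenCenter 𝒜) (hp0 : p ≠ 0) (hq0 : q ≠ 0) (h : p * q = 0) =>
      hq0 (hcancel hp hp0 h)
    refine ⟨z₀ * z₁ * (z₂ * z₃), M (M hz₀ hz₁) (M hz₂ hz₃),
      N (M hz₀ hz₁) (N hz₀ n₀ n₁) (N hz₂ n₂ n₃),
      w₀ * z₁ * (z₂ * z₃) + z₀ * w₁ * (z₂ * z₃) * a + z₀ * z₁ * (w₂ * z₃) * b +
        z₀ * z₁ * (z₂ * w₃) * (a * b), ?_⟩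
    have v₀ := M (M hw₀ hz₁) (M hz₂ hz₃)
    have v₁ := M (M hz₀ hw₁) (M hz₂ hz₃)
    have v₂ := M (M hz₀ hz₁) (M hw₂ hz₃)
    have v₃ := M (M hz₀ hz₁) (M hz₂ hw₃)
    change f _ * q = f _
    rw [hfZ _ (M (M hz₀ hz₁) (M hz₂ hz₃)),
      hf hKmem hK0 (M hKmem v₀) (M hKmem v₁) (M hKmem v₂) (M hKmem v₃)
        (by noncomm_ring), φmul _ hKmem _ v₀, φmul _ hKmem _ v₁, φmul _ hKmem _ v₂,
        φmul _ hKmem _ v₃, φmul _ (M hz₀ hz₁) _ (M hz₂ hz₃), φmul _ (M hw₀ hz₁) _ (M hz₂ hz₃),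
        φmul _ (M hz₀ hw₁) _ (M hz₂ hz₃), φmul _ (M hz₀ hz₁) _ (M hw₂ hz₃),
        φmul _ (M hz₀ hz₁) _ (M hz₂ hw₃), φmul _ hz₀ _ hz₁, φmul _ hz₂ _ hz₃, φmul _ hw₀ _ hz₁,
        φmul _ hz₀ _ hw₁, φmul _ hw₂ _ hz₃, φmul _ hz₂ _ hw₃, ← k₀, ← k₁, ← k₂, ← k₃,
        ← Algebra.smul_def]
    ext <;> simp [hφK] <;> ring
  · intro c
    obtain ⟨z, hz, n, w, hw, k⟩ := φfrac c
    refine ⟨z, hz, n, w, hw, ?_⟩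
    change f z * _ = f w
    rw [hfZ z hz, hfZ w hw, ← map_mul, k]
  · exact ⟨1, 1, by simp⟩
  · intro J hJ
    exact quaternion_ideal_eq hF2 (φne _ hs hs0) (φne _ hr hr0) J
      (fun q y hy => hJ.mul_mem_left q hy) (fun q y hy => hJ.mul_mem_right q hy)

end Criterion

/-! ### Quaternion pairs from an odd square-zero element -/

section OddNilpotent

universe u

variable {R : Type*} {A : Type u} [CommRing R] [NonUnitalRing A] [Module R A]
  [IsScalarTower R A A] [SMulCommClass R A A]
  {𝒜 : ZMod 2 → Submodule R A} [SetLike.GradedMul 𝒜] [DirectSum.Decomposition 𝒜]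
  {I : Submodule R A} {a b : A}

/-- The centralizer of homogeneous elements is graded, so the centralizer condition can be checked
on each parity. -/
theorem IsPrimeSuperalgebra.isCentralOrderInSimple_of_odd (h2 : IsUnit (2 : R))
    (hprime : IsPrimeSuperalgebra 𝒜) (ha : a ∈ 𝒜 0) (hb : b ∈ 𝒜 1)
    (hab : a * b = -(b * a)) (hs : a * a ∈ evenCenter 𝒜) (hs0 : a * a ≠ 0)
    (hr : b * b ∈ evenCenter 𝒜) (hr0 : b * b ≠ 0)
    (hC0 : ∀ x ∈ 𝒜 0, a * x = x * a → b * x = x * b → x ∈ evenCenter 𝒜)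
    (hC1 : ∀ x ∈ 𝒜 1, a * x = x * a → b * x = x * b → x = 0) :
    IsCentralOrderInSimple 𝒜 4 := by
  refine hprime.isCentralOrderInSimple h2 ha hb hab hs hs0 hr hr0 fun x hax hbx => ?_
  obtain ⟨x₀, x₁, h0, h1, rfl⟩ : ∃ x₀ x₁, x₀ ∈ 𝒜 0 ∧ x₁ ∈ 𝒜 1 ∧ x = x₀ + x₁ :=
    ⟨_, _, comp_mem_grade 𝒜 x 0, comp_mem_grade 𝒜 x 1, (comp_add_comp 𝒜 x).symm⟩
  have e1 := eq_zero_of_even_add_odd 𝒜 (x := a * x₀ - x₀ * a) (y := a * x₁ - x₁ * a)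
    (sub_mem (even_mul_even ha h0) (even_mul_even h0 ha))
    (sub_mem (even_mul_odd ha h1) (odd_mul_even h1 ha))
    (by linear_combination (norm := noncomm_ring) hax)
  have e2 := eq_zero_of_even_add_odd 𝒜 (x := b * x₁ - x₁ * b) (y := b * x₀ - x₀ * b)
    (sub_mem (odd_mul_odd hb h1) (odd_mul_odd h1 hb))
    (sub_mem (odd_mul_even hb h0) (even_mul_odd h0 hb))
    (by linear_combination (norm := noncomm_ring) hbx)
  rw [hC1 x₁ h1 (sub_eq_zero.1 e1.2) (sub_eq_zero.1 e2.1), add_zero]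
  exact hC0 x₀ h0 (sub_eq_zero.1 e1.1) (sub_eq_zero.1 e2.2)

/-- An odd square-zero element `c` with `c I₀ c = 0`, for which the elements `c x + x c` have
central Jordan products, forces `A` to be a central order in a quaternion algebra. -/
theorem IsPrimeSuperalgebra.isCentralOrderInSimple_of_nilpotent (h2 : IsUnit (2 : R))
    (hprime : IsPrimeSuperalgebra 𝒜) (hI : IsSuperideal 𝒜 I) (hI0 : I ≠ ⊥) {c : A}
    (hc : c ∈ 𝒜 1) (hc0 : c ≠ 0) (hcc : c * c = 0)
    (hcI : ∀ w ∈ I, w ∈ 𝒜 0 → c * w * c = 0)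
    (hW : ∀ x ∈ I, x ∈ 𝒜 1 → ∀ y ∈ I, y ∈ 𝒜 1 →
      (c * x + x * c) * (c * y + y * c) + (c * y + y * c) * (c * x + x * c) ∈ evenCenter 𝒜)
    (hcomm : ∀ x ∈ I, x ∈ 𝒜 1 → ∀ y ∈ I, y ∈ 𝒜 1 → c * x * c * y * c = c * y * c * x * c) :
    IsCentralOrderInSimple 𝒜 4 := by
  have hcancel : ∀ {z x : A}, z ∈ evenCenter 𝒜 → z ≠ 0 → z * x = 0 → x = 0 :=
    fun hz hz0 h => hprime.eq_zero_of_evenCenter_mul hz hz0 h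
  have hcc' : ∀ t, c * (c * t) = 0 := fun t => by rw [← mul_assoc, hcc, zero_mul]
  have hT : ∀ x ∈ I, x ∈ 𝒜 1 → ∀ y ∈ I, y ∈ 𝒜 1 →
      ((c * x + x * c) * (c * y + y * c) + (c * y + y * c) * (c * x + x * c)) * c =
        2 • (c * x * c * y * c) := by
    intro x hx hx1 y hy hy1
    rw [two_smul]
    nth_rewrite 2 [hcomm x hx hx1 y hy hy1]
    simp [mul_add, add_mul, mul_assoc, hcc, hcc']
  -- Otherwise polarization, with `hcomm`, gives `cxcyc = 0` on `I₁`. With `c I₀ c = 0` this yields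
  -- `(cxc)Ic = 0`, then `cIc = 0`, then `c = 0`.
  obtain ⟨x, hx, hx1, hxne⟩ : ∃ x ∈ I, x ∈ 𝒜 1 ∧ c * x * c * x * c ≠ 0 := by
    by_contra! H
    have H2 : ∀ x ∈ I, x ∈ 𝒜 1 → ∀ y ∈ I, y ∈ 𝒜 1 → c * x * c * y * c = 0 := by
      intro x hx hx1 y hy hy1
      have e := H (x + y) (add_mem hx hy) (add_mem hx1 hy1)
      apply eq_zero_of_add_self h2
      linear_combination (norm := noncomm_ring) e - H x hx hx1 - H y hy hy1 +
        hcomm x hx hx1 y hy hy1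
    refine hc0 ((hprime.eq_zero_or_of_mul_mul hI hI0 hc (x := c) ?_).elim id id)
    refine hI.forall_of_homogeneous
      (fun p q hp hq => by rw [mul_add, add_mul, hp, hq, add_zero]) hcI fun x hx hx1 => ?_
    refine (hprime.eq_zero_or_of_mul_mul hI hI0 hc (x := c * x * c) ?_).resolve_right hc0
    refine hI.forall_of_homogeneous
      (fun p q hp hq => by rw [mul_add, add_mul, hp, hq, add_zero]) ?_ (H2 x hx hx1)
    intro w hw hw0
    linear_combination (norm := noncomm_ring) c * x * hcI w hw hw0
  obtain ⟨t, ht⟩ : ∃ t, t = (c * x + x * c) * (c * x + x * c) := ⟨_, rfl⟩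
  have htZ : t ∈ evenCenter 𝒜 := evenCenter.of_add_self h2 (ht ▸ hW x hx hx1 x hx hx1)
  have htc : t * c = c * x * c * x * c := by
    rw [ht]
    simp [mul_add, add_mul, mul_assoc, hcc, hcc']
  have htc0 : t * c ≠ 0 := htc ▸ hxne
  have ht0 : t ≠ 0 := fun h => htc0 (by rw [h, zero_mul])
  -- Model: `c = e₁₂` and `y = t e₂₁`, so that `cy + yc = t`.
  obtain ⟨y, hy⟩ : ∃ y, y = x * c * x := ⟨_, rfl⟩
  have hyI : y ∈ I := hy ▸ hI.mul_mem_left _ hx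
  have hy1 : y ∈ 𝒜 1 := hy ▸ even_mul_odd (odd_mul_odd hx1 hc) hx1
  have hyy : y * y = 0 := by
    rw [hy]
    linear_combination (norm := noncomm_ring)
      x * hcI _ (hI.mul_mem_left x hx) (odd_mul_odd hx1 hx1) * x
  have hcyc : c * y * c = t * c := by rw [hy, htc]; noncomm_ring
  have hycy : y * c * y = t * y := by
    have : y * c * y = x * (t * c) * x := by rw [hy, htc]; noncomm_ring
    rw [this, hy]
    linear_combination (norm := noncomm_ring) -htZ.2 x * c * x
  -- For `w = cy + yc` one has `w² = tw`. Since `w²` is central, so is `w`, and cancelling `w ≠ 0`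
  -- gives `w = t`.
  have hw : c * y + y * c = t := by
    have hww : (c * y + y * c) * (c * y + y * c) = t * (c * y + y * c) := by
      linear_combination (norm := noncomm_ring) hcyc * y + hycy * c + c * hyy * c + y * hcc * y
    have hwwZ := evenCenter.of_add_self h2 (hW y hyI hy1 y hyI hy1)
    have hwZ := hprime.evenCenter_of_mul_mem htZ ht0 (hww ▸ hwwZ)
    have hw0 : c * y + y * c ≠ 0 := by
      intro h
      apply htc0
      linear_combination (norm := noncomm_ring) h * c - hcyc - y * hcc
    refine sub_eq_zero.1 (hcancel hwZ hw0 ?_)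
    linear_combination (norm := noncomm_ring) hww + htZ.2 (c * y + y * c)
  have hbb : (c + y) * (c + y) = t := by
    linear_combination (norm := noncomm_ring) hw + hcc + hyy
  have haa : (c * y - y * c) * (c * y - y * c) = t * t := by
    linear_combination (norm := noncomm_ring) hcyc * y + hycy * c - c * hyy * c - y * hcc * y
      + t * hw
  have htt0 : t * t ≠ 0 := fun h => ht0 (hcancel htZ ht0 h)
  have hba : (c + y) * (c * y - y * c) = -(t * (c - y)) := by
    linear_combination (norm := noncomm_ring) hcc * y - hcyc + hycy - hyy * c
  have hab : (c * y - y * c) * (c + y) = t * (c - y) := by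
    linear_combination (norm := noncomm_ring) -y * hcc + hcyc - hycy + c * hyy
  -- The product of the pair is `t(c - y)`, so commuting with both means commuting with `c - y` and
  -- `c + y`, hence with `c` and `y`.
  have hcen : ∀ v, (c * y - y * c) * v = v * (c * y - y * c) → (c + y) * v = v * (c + y) →
      c * v = v * c ∧ y * v = v * y := by
    intro v hav hbv
    have e1 : (c - y) * v - v * (c - y) = 0 := by
      refine hcancel htZ ht0 ?_
      linear_combination (norm := noncomm_ring) -hab * v + v * hab + (c * y - y * c) * hbv +
        hav * (c + y) - htZ.2 v * (c - y)
    have e2 : c * v - v * c = 0 := by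
      apply eq_zero_of_add_self h2
      linear_combination (norm := noncomm_ring) e1 + hbv
    refine ⟨sub_eq_zero.1 e2, ?_⟩
    linear_combination (norm := noncomm_ring) hbv - e2
  refine hprime.isCentralOrderInSimple_of_odd h2 (a := c * y - y * c) (b := c + y)
    (sub_mem (odd_mul_odd hc hy1) (odd_mul_odd hy1 hc)) (add_mem hc hy1)
    (by rw [hab, hba, neg_neg]) (haa ▸ evenCenter.mul_mem htZ htZ) (haa ▸ htt0) (hbb ▸ htZ)
    (hbb ▸ ht0) ?_ ?_
  · intro v hv hav hbv
    obtain ⟨hcv, hyv⟩ := hcen v hav hbv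
    have hvy1 : v * y ∈ 𝒜 1 := even_mul_odd hv hy1
    have hvyI : v * y ∈ I := hI.mul_mem_left v hyI
    have hz := hW (v * y) hvyI hvy1 y hyI hy1
    have hzc := hT (v * y) hvyI hvy1 y hyI hy1
    generalize (c * (v * y) + v * y * c) * (c * y + y * c) +
      (c * y + y * c) * (c * (v * y) + v * y * c) = z at hz hzc
    have e1 : z * c = 2 • (t * t * v) * c := by
      rw [hzc]
      linear_combination (norm := noncomm_ring) 2 • (hcv * y * c * y * c) +
        2 • (v * hcyc * y * c) + 2 • (v * t * hcyc) - 2 • (htZ.2 v * t * c)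
        - 2 • (t * htZ.2 v * c)
    -- The difference commutes with `y` and is killed by `c` on the right, so its product with `cy +
    -- yc = t` vanishes.
    have e2 : 2 • (t * t * v) - z = 0 := by
      refine hcancel htZ ht0 ?_
      have hg : y * (2 • (t * t * v) - z) = (2 • (t * t * v) - z) * y := by
        linear_combination (norm := noncomm_ring) 2 • (t * t * hyv) - 2 • (htZ.2 y * t * v) -
          2 • (t * htZ.2 y * v) + hz.2 y
      have hzt : t * (2 • (t * t * v) - z) = (2 • (t * t * v) - z) * (c * y + y * c) := by
        rw [hw]
        exact htZ.2 _
      linear_combination (norm := noncomm_ring) hzt - e1 * y - hg * c - y * e1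
    have e3 : t * t * v + t * t * v ∈ evenCenter 𝒜 := by
      rw [← two_smul ℕ, sub_eq_zero.1 e2]
      exact hz
    exact hprime.evenCenter_of_mul_mem (evenCenter.mul_mem htZ htZ) htt0
      (evenCenter.of_add_self h2 e3)
  · intro v hv hav hbv
    obtain ⟨hcv, hyv⟩ := hcen v hav hbv
    have e := hcI _ (hI.mul_mem_left v hyI) (odd_mul_odd hv hy1)
    have e1 : v * c = 0 := by
      refine hcancel htZ ht0 ?_
      linear_combination (norm := noncomm_ring) e - hcv * y * c - v * hcyc + htZ.2 v * c
    refine hcancel htZ ht0 ?_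
    have hvt : t * v = v * (c * y + y * c) := by
      rw [hw]
      exact htZ.2 v
    linear_combination (norm := noncomm_ring) hvt + e1 * y - hyv * c + y * e1

end OddNilpotent

/-! ### The homogeneous elements of `U` -/

section Homogeneous

universe u

variable {R : Type*} {A : Type u} [CommRing R] [NonUnitalRing A] [Module R A]
  [IsScalarTower R A A] [SMulCommClass R A A]
  {𝒜 : ZMod 2 → Submodule R A} [SetLike.GradedMul 𝒜] [DirectSum.Decomposition 𝒜]
  {I : Submodule R A} {a u : A}

/-- Replacing `w` by `wy` and using `[a, wy] = [a, w]y + w[a, y]` gives `[a, y]w[a, y] = 0`. -/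
theorem IsPrimeSuperalgebra.commute_of_forall_even (hprime : IsPrimeSuperalgebra 𝒜)
    (hI : IsSuperideal 𝒜 I) (hI0 : I ≠ ⊥) (hA : ∀ x : A, x ∈ 𝒜 0)
    (h : ∀ y ∈ I, ∀ w ∈ I, (a * y - y * a) * (a * w - w * a) = 0) (x : A) : a * x = x * a := by
  refine hprime.commute_of_commute_ideal hI hI0 (fun y hy => ?_) x
  rw [← sub_eq_zero]
  refine (hprime.eq_zero_or_of_mul_mul hI hI0 (hA (a * y - y * a)) (x := a * y - y * a)
    fun w hw => ?_).elim id id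
  linear_combination (norm := noncomm_ring) h y hy (w * y) (hI.mul_mem_right y hw) -
    h y hy w hw * y

/-- In a trivially graded prime superalgebra, a noncentral subgroup closed under commutators with
`I` contains a noncentral element of nonzero square. -/
theorem IsPrimeSuperalgebra.exists_sq_ne_zero (h2 : IsUnit (2 : R))
    (hprime : IsPrimeSuperalgebra 𝒜) (hI : IsSuperideal 𝒜 I) (hI0 : I ≠ ⊥) (U : AddSubgroup A)
    (hA : ∀ x : A, x ∈ 𝒜 0) (hU : ∀ u ∈ U, ∀ y ∈ I, u * y - y * u ∈ U)
    (ha : a ∈ U)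
    (haZ : a ∉ evenCenter 𝒜) : ∃ b ∈ U, b ∉ evenCenter 𝒜 ∧ b * b ≠ 0 := by
  by_cases haa : a * a = 0
  · by_contra! H
    have ha0 : a ≠ 0 := fun h => haZ (h ▸ evenCenter.zero_mem)
    have hanti : ∀ y, a * (a * y - y * a) = -((a * y - y * a) * a) := fun y => by
      linear_combination (norm := noncomm_ring) haa * y - y * haa
    have hsq : ∀ y ∈ I, (a * y - y * a) * (a * y - y * a) = 0 := by
      intro y hy
      -- If `[a, y]² ≠ 0`, then `[a, y]` is central. It also anticommutes with `a`, because `a² =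
      -- 0`, so `[a, y]a = 0` and `a = 0`.
      by_contra hb
      refine hb (H _ (hU a ha y hy) fun hZ => ?_)
      have h1 : (a * y - y * a) * a = 0 := by
        apply eq_zero_of_add_self h2
        linear_combination (norm := noncomm_ring) hZ.2 a + hanti y
      have hb0 : a * y - y * a ≠ 0 := fun h => hb (by rw [h, zero_mul])
      exact ha0 (hprime.eq_zero_of_evenCenter_mul hZ hb0 h1)
    have hlin : ∀ y ∈ I, ∀ w ∈ I, a * y * a * w * a + a * w * a * y * a = 0 := by
      intro y hy w hw
      have e := hsq (y + w) (add_mem hy hw)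
      linear_combination (norm := noncomm_ring) a * e - a * hsq y hy - a * hsq w hw
        - haa * y * a * w - haa * w * a * y + haa * y * w * a + haa * w * y * a
        + a * y * haa * w + a * w * haa * y
    -- By `hlin`, exchanging two arguments changes the sign. Moving `y` past the block `wav` costs
    -- one sign, moving it back past `v` and `w` costs two, so the expression is its own negative.
    have htriple : ∀ y ∈ I, ∀ w ∈ I, ∀ v ∈ I, a * y * a * w * a * v * a = 0 := by
      intro y hy w hw v hv
      apply eq_zero_of_add_self h2
      have e1 := hlin y hy (w * a * v) (hI.mul_mem_left _ hv)
      have e2 := hlin v hv y hy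
      have e3 := hlin w hw y hy
      linear_combination (norm := noncomm_ring) e1 - a * w * e2 + e3 * v * a
    have hK : ∀ {x : A}, (∀ w ∈ I, x * w * a = 0) → x = 0 := fun h =>
      (hprime.eq_zero_or_of_mul_mul hI hI0 (hA a) h).resolve_right ha0
    refine ha0 (hK fun y hy => hK fun w hw => hK fun v hv => htriple y hy w hw v hv)
  · exact ⟨a, ha, haZ, haa⟩

/-- The trivially graded case of the theorem. -/
theorem IsPrimeSuperalgebra.isCentralOrderInSimple_of_trivial_grading (h2 : IsUnit (2 : R))
    (hprime : IsPrimeSuperalgebra 𝒜) (hI : IsSuperideal 𝒜 I) (hI0 : I ≠ ⊥) (U : AddSubgroup A)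
    (hA : ∀ x : A, x ∈ 𝒜 0) (hU : ∀ u ∈ U, ∀ y ∈ I, u * y - y * u ∈ U)
    (he : ∀ u ∈ U, ∀ v ∈ U, u * v + v * u ∈ evenCenter 𝒜) (hUZ : ∃ u ∈ U, u ∉ evenCenter 𝒜) :
    IsCentralOrderInSimple 𝒜 4 := by
  obtain ⟨u, hu, huZ⟩ := hUZ
  obtain ⟨a, ha, haZ, hs0⟩ := hprime.exists_sq_ne_zero h2 hI hI0 U hA hU hu huZ
  have hsq : ∀ u ∈ U, u * u ∈ evenCenter 𝒜 := fun u hu => evenCenter.of_add_self h2 (he u hu u hu)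
  have hs := hsq a ha
  have hanti : ∀ y, a * (a * y - y * a) = -((a * y - y * a) * a) := fun y => by
    linear_combination (norm := noncomm_ring) hs.2 y
  obtain ⟨y, hy, hr0⟩ : ∃ y ∈ I, (a * y - y * a) * (a * y - y * a) ≠ 0 := by
    by_contra! H
    have hlin : ∀ y ∈ I, ∀ w ∈ I, (a * y - y * a) * (a * w - w * a) +
        (a * w - w * a) * (a * y - y * a) = 0 := by
      intro y hy w hw
      linear_combination (norm := noncomm_ring) H (y + w) (add_mem hy hw) - H y hy - H w hw
    refine haZ ⟨hA a, hprime.commute_of_forall_even hI hI0 hA fun y hy w hw => ?_⟩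
    refine hprime.eq_zero_of_evenCenter_mul hs hs0 (eq_zero_of_add_self h2 ?_)
    -- As `[a, aw] = a[a, w]` and `[a, y]` anticommutes with `a`, this instance gives a relation of
    -- opposite sign to `hlin y hy w hw`; together they kill `[a, y][a, w]`.
    have e := hlin y hy (a * w) (hI.mul_mem_left a hw)
    linear_combination (norm := noncomm_ring) -a * e + a * hanti y * (a * w - w * a) + a * a * hlin y hy w hw
  obtain ⟨b, hb⟩ : ∃ b, b = a * y - y * a := ⟨_, rfl⟩
  have hbU : b ∈ U := hb ▸ hU a ha y hy
  have hbI : b ∈ I := hb ▸ sub_mem (hI.mul_mem_left a hy) (hI.mul_mem_right a hy)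
  have hab : a * b = -(b * a) := hb ▸ hanti y
  rw [← hb] at hr0
  have hr := hsq b hbU
  refine hprime.isCentralOrderInSimple h2 (hA a) (hA b) hab hs hs0 hr hr0 fun x hax hbx => ?_
  -- For `x` in the centralizer this puts `2a²xb` into `U`; its Jordan product with `b` is `4a²b²x`,
  -- which places `x` in `Z`.
  have e1 : a * (a * x * b) - a * x * b * a = 2 • (a * a * x * b) := by
    linear_combination (norm := noncomm_ring) -(a * x * hab) - a * hax * b
  have e2 := he b hbU _ (e1 ▸ hU a ha (a * x * b) (hI.mul_mem_left _ hbI))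
  have e3 : b * (2 • (a * a * x * b)) + 2 • (a * a * x * b) * b =
      (a * a * (b * b) * x + a * a * (b * b) * x) + (a * a * (b * b) * x + a * a * (b * b) * x) := by
    linear_combination (norm := noncomm_ring) -(2 • (hs.2 b * x * b)) + 2 • (a * a * hbx * b)
      - 4 • (a * a * hr.2 x)
  rw [e3] at e2
  have e4 := evenCenter.of_add_self h2 (evenCenter.of_add_self h2 e2)
  exact hprime.evenCenter_of_mul_mem (evenCenter.mul_mem hs hr)
    (fun h => hr0 (hprime.eq_zero_of_evenCenter_mul hs hs0 h)) e4

/-- An odd element commuting with the even part of a nonzero ideal is central. -/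
theorem IsPrimeSuperalgebra.odd_commute_of_commute_even (hprime : IsPrimeSuperalgebra 𝒜)
    (hI : IsSuperideal 𝒜 I) (hI0 : I ≠ ⊥) (hu : u ∈ 𝒜 1)
    (h : ∀ w ∈ I, w ∈ 𝒜 0 → u * w = w * u) (x : A) : u * x = x * u := by
  refine hprime.commute_of_commute_ideal hI hI0 ?_ x
  refine hI.forall_of_homogeneous (fun p q hp hq => by rw [mul_add, add_mul, hp, hq]) h ?_
  intro x hx hx1
  have hku : ∀ x ∈ I, x ∈ 𝒜 1 → (u * x - x * u) * u = 0 := fun x hx hx1 => by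
    linear_combination (norm := noncomm_ring) h _ (hI.mul_mem_right u hx) (odd_mul_odd hx1 hu)
  rw [← sub_eq_zero]
  -- It remains to see that `[u, x]Iu = 0`: an even `w` commutes with `u`, and for an odd `y` the
  -- even element `xy` does.
  refine (hprime.eq_zero_or_of_mul_mul hI hI0 hu ?_).elim id fun h0 => by
    rw [h0, zero_mul, mul_zero, sub_zero]
  refine hI.forall_of_homogeneous
    (fun p q hp hq => by rw [mul_add, add_mul, hp, hq, add_zero]) ?_ ?_
  · intro w hw hw0
    linear_combination (norm := noncomm_ring) -((u * x - x * u) * h w hw hw0) + hku x hx hx1 * w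
  · intro y hy hy1
    linear_combination (norm := noncomm_ring)
      h _ (hI.mul_mem_right y hx) (odd_mul_odd hx1 hy1) * u - x * hku y hy hy1

/-- If there is a nonzero odd central element and the even part of a nonzero ideal is
commutative, then `A` is commutative. -/
theorem IsPrimeSuperalgebra.commutative_of_odd_central (hprime : IsPrimeSuperalgebra 𝒜)
    (hI : IsSuperideal 𝒜 I) (hI0 : I ≠ ⊥) (hu : u ∈ 𝒜 1) (hu0 : u ≠ 0)
    (hc : ∀ a, u * a = a * u)
    (h : ∀ x ∈ I, x ∈ 𝒜 0 → ∀ y ∈ I, y ∈ 𝒜 0 → x * y = y * x) (a b : A) : a * b = b * a := by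
  -- Multiplication by `u` is injective and reverses parity, so commutativity of `I₀` carries over
  -- to mixed and to odd pairs.
  have hcancel : ∀ {x : A}, u * x = 0 → x = 0 := fun e =>
    (hprime.eq_zero_or_of_central_mul hI hI0 hu hc e).resolve_left hu0
  have h01 : ∀ x ∈ I, x ∈ 𝒜 0 → ∀ y ∈ I, y ∈ 𝒜 1 → x * y = y * x := by
    intro x hx hx0 y hy hy1
    rw [← sub_eq_zero]
    apply hcancel
    linear_combination (norm := noncomm_ring)
      h x hx hx0 _ (hI.mul_mem_left u hy) (odd_mul_odd hu hy1) + hc x * y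
  have h11 : ∀ x ∈ I, x ∈ 𝒜 1 → ∀ y ∈ I, y ∈ 𝒜 1 → x * y = y * x := by
    intro x hx hx1 y hy hy1
    rw [← sub_eq_zero]
    apply hcancel
    linear_combination (norm := noncomm_ring)
      h01 _ (hI.mul_mem_left u hx) (odd_mul_odd hu hx1) y hy hy1 - hc y * x
  refine hprime.commutative_of_ideal hI hI0 ?_ a b
  refine hI.forall_of_homogeneous
    (fun p q hp hq y hy => by rw [mul_add, add_mul, hp y hy, hq y hy]) ?_ ?_
  · intro x hx hx0
    exact hI.forall_of_homogeneous (fun p q hp hq => by rw [mul_add, add_mul, hp, hq])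
      (h x hx hx0) (h01 x hx hx0)
  · intro x hx hx1
    exact hI.forall_of_homogeneous (fun p q hp hq => by rw [mul_add, add_mul, hp, hq])
      (fun y hy hy0 => (h01 y hy hy0 x hx hx1).symm) (h11 x hx hx1)

theorem IsPrimeSuperalgebra.sq_ne_zero_of_central (hprime : IsPrimeSuperalgebra 𝒜)
    (hI : IsSuperideal 𝒜 I) (hI0 : I ≠ ⊥) (hu : u ∈ 𝒜 1) (hu0 : u ≠ 0)
    (hc : ∀ a, u * a = a * u) : u * u ≠ 0 := fun h =>
  hu0 ((hprime.eq_zero_or_of_central_mul hI hI0 hu hc h).elim id id)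

/-- The theorem, with the conclusion for the homogeneous elements of `U`. -/
theorem IsPrimeSuperalgebra.homogeneous_trichotomy (h2 : IsUnit (2 : R))
    (hprime : IsPrimeSuperalgebra 𝒜) (hI : IsSuperideal 𝒜 I) (hI0 : I ≠ ⊥) (U : AddSubgroup A)
    (hU : ∀ u ∈ U, ∀ i, u ∈ 𝒜 i → ∀ y ∈ I, y ∈ 𝒜 0 → u * y - y * u ∈ U)
    (hU01 : ∀ u ∈ U, u ∈ 𝒜 0 → ∀ y ∈ I, y ∈ 𝒜 1 → u * y - y * u ∈ U)
    (hU11 : ∀ u ∈ U, u ∈ 𝒜 1 → ∀ y ∈ I, y ∈ 𝒜 1 → u * y + y * u ∈ U)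
    (he : ∀ u ∈ U, ∀ v ∈ U, u ∈ 𝒜 0 → v ∈ 𝒜 0 → u * v + v * u ∈ evenCenter 𝒜)
    (ho : ∀ u ∈ U, ∀ v ∈ U, u ∈ 𝒜 1 → v ∈ 𝒜 1 → u * v = v * u) :
    (∀ a b : A, a * b = b * a) ∨ IsCentralOrderInSimple 𝒜 4 ∨
      ((∀ u ∈ U, u ∈ 𝒜 0 → u ∈ evenCenter 𝒜) ∧ ∀ u ∈ U, u ∈ 𝒜 1 → u = 0) := by
  by_cases hA1 : ∀ x ∈ 𝒜 1, x = 0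
  · have hA : ∀ x : A, x ∈ 𝒜 0 := fun x => by
      rw [← comp_add_comp 𝒜 x, hA1 _ (comp_mem_grade 𝒜 x 1), add_zero]
      exact comp_mem_grade 𝒜 x 0
    by_cases hZ : ∀ u ∈ U, u ∈ evenCenter 𝒜
    · exact Or.inr (Or.inr ⟨fun u hu _ => hZ u hu, fun u _ hu1 => hA1 u hu1⟩)
    · push Not at hZ
      exact Or.inr (Or.inl (hprime.isCentralOrderInSimple_of_trivial_grading h2 hI hI0 U hA
        (fun u hu y hy => hU u hu 0 (hA u) y hy (hA y))
        (fun u hu v hv => he u hu v hv (hA u) (hA v)) hZ))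
  push Not at hA1
  obtain ⟨v, hv1, hv0⟩ := hA1
  by_cases hU1 : ∀ u ∈ U, u ∈ 𝒜 1 → u = 0
  · refine Or.inr (Or.inr ⟨fun u hu hu0 => ⟨hu0, ?_⟩, hU1⟩)
    refine hprime.commute_of_commute_odd hI hI0 hv1 hv0 fun w hw hw1 => ?_
    exact sub_eq_zero.1 (hU1 _ (hU01 u hu hu0 w hw hw1)
      (sub_mem (even_mul_odd hu0 hw1) (odd_mul_even hw1 hu0)))
  push Not at hU1
  obtain ⟨u, hu, hu1, hu0⟩ := hU1
  by_cases hcen : ∀ u ∈ U, u ∈ 𝒜 1 → ∀ y ∈ I, y ∈ 𝒜 0 → u * y = y * u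
  · left
    have hcen' : ∀ u ∈ U, u ∈ 𝒜 1 → ∀ x, u * x = x * u := fun u hu hu1 =>
      hprime.odd_commute_of_commute_even hI hI0 hu1 (hcen u hu hu1)
    have hc := hcen' u hu hu1
    have hs : u * u ∈ evenCenter 𝒜 :=
      ⟨odd_mul_odd hu1 hu1, fun x => by rw [mul_assoc, hc, ← mul_assoc, hc, mul_assoc]⟩
    have hs0 := hprime.sq_ne_zero_of_central hI hI0 hu1 hu0 hc
    have hss := evenCenter.mul_mem hs hs
    have hss0 : u * u * (u * u) ≠ 0 := fun h => hs0 (hprime.eq_zero_of_evenCenter_mul hs hs0 h)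
    have hmem : ∀ x ∈ I, x ∈ 𝒜 0 → 2 • (u * u * x) ∈ U := by
      intro x hx hx0
      have := hU11 u hu hu1 _ (hI.mul_mem_left u hx) (odd_mul_even hu1 hx0)
      have e : u * (u * x) + u * x * u = 2 • (u * u * x) := by
        linear_combination (norm := noncomm_ring) -(u * hc x)
      rwa [e] at this
    refine hprime.commutative_of_odd_central hI hI0 hu1 hu0 hc fun x hx hx0 y hy hy0 => ?_
    have hm : ∀ x ∈ 𝒜 0, 2 • (u * u * x) ∈ 𝒜 0 := fun x hx0 =>
      nsmul_mem (even_mul_even hs.1 hx0) 2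
    have e1 : x * y + y * x ∈ evenCenter 𝒜 := by
      have h := he _ (hmem x hx hx0) _ (hmem y hy hy0) (hm x hx0) (hm y hy0)
      have e : 2 • (u * u * x) * (2 • (u * u * y)) + 2 • (u * u * y) * (2 • (u * u * x)) =
          (u * u * (u * u) * (x * y + y * x) + u * u * (u * u) * (x * y + y * x)) +
          (u * u * (u * u) * (x * y + y * x) + u * u * (u * u) * (x * y + y * x)) := by
        linear_combination (norm := noncomm_ring)
          -(4 • (u * u * hs.2 x * y)) - 4 • (u * u * hs.2 y * x)
      rw [e] at h
      exact hprime.evenCenter_of_mul_mem hss hss0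
        (evenCenter.of_add_self h2 (evenCenter.of_add_self h2 h))
    -- The odd element `[2u²x, uy]` of `U` is central, and its product with `u` is `2u⁴[x, y]`.
    have e2 : x * y - y * x ∈ evenCenter 𝒜 := by
      have h := hcen' _ (hU01 _ (hmem x hx hx0) (hm x hx0) (u * y) (hI.mul_mem_left u hy)
        (odd_mul_even hu1 hy0)) (sub_mem (even_mul_odd (hm x hx0) (odd_mul_even hu1 hy0))
        (odd_mul_even (odd_mul_even hu1 hy0) (hm x hx0)))
      refine hprime.evenCenter_of_mul_mem hss hss0 (evenCenter.of_add_self h2 ⟨?_, fun w => ?_⟩)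
      · exact add_mem (even_mul_even hss.1 (sub_mem (even_mul_even hx0 hy0) (even_mul_even hy0 hx0)))
          (even_mul_even hss.1 (sub_mem (even_mul_even hx0 hy0) (even_mul_even hy0 hx0)))
      · have e : u * (2 • (u * u * x) * (u * y) - u * y * (2 • (u * u * x))) =
            u * u * (u * u) * (x * y - y * x) + u * u * (u * u) * (x * y - y * x) := by
          linear_combination (norm := noncomm_ring)
            -(2 • (u * u * u * hc x * y)) + 2 • (u * u * hs.2 y * x)
        rw [← e, mul_assoc, h w, ← mul_assoc, hc w, mul_assoc]
    have e3 : x * y ∈ evenCenter 𝒜 := by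
      apply evenCenter.of_add_self h2
      have := evenCenter.add_mem e1 e2
      rwa [add_add_sub_cancel] at this
    -- Both `[x, y]` and `xy` are central, so `[x, y]x = x·xy - xy·x = 0`; a nonzero central `[x,
    -- y]` would force `x = 0`.
    have e4 : (x * y - y * x) * x = 0 := by
      linear_combination (norm := noncomm_ring) e2.2 x - e3.2 x
    by_contra hne
    have := hprime.eq_zero_of_evenCenter_mul e2 (sub_ne_zero.2 hne) e4
    exact hne (by rw [this, zero_mul, mul_zero])
  · right; left
    push Not at hcen
    obtain ⟨u, hu, hu1, y, hy, hy0, hne⟩ := hcen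
    obtain ⟨c, hcd⟩ : ∃ c, c = u * y - y * u := ⟨_, rfl⟩
    have hd1 : ∀ z ∈ 𝒜 0, u * z - z * u ∈ 𝒜 1 := fun z hz0 =>
      sub_mem (odd_mul_even hu1 hz0) (even_mul_odd hz0 hu1)
    have hdu : ∀ z ∈ I, z ∈ 𝒜 0 → u * (u * z - z * u) = (u * z - z * u) * u := fun z hz hz0 =>
      ho _ hu _ (hU u hu 1 hu1 z hz hz0) hu1 (hd1 z hz0)
    -- The derivation `D = [u, ·]` satisfies `D² = 0` on `I₀`, and `D²(zw) = 2D(z)D(w)` by the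
    -- Leibniz rule.
    have hdd : ∀ z ∈ I, z ∈ 𝒜 0 → ∀ w ∈ I, w ∈ 𝒜 0 →
        (u * z - z * u) * (u * w - w * u) = 0 := by
      intro z hz hz0 w hw hw0
      apply eq_zero_of_add_self h2
      linear_combination (norm := noncomm_ring)
        hdu _ (hI.mul_mem_right w hz) (even_mul_even hz0 hw0) - hdu z hz hz0 * w - z * hdu w hw hw0
    have hcU : c ∈ U := hcd ▸ hU u hu 1 hu1 y hy hy0
    have hc1 : c ∈ 𝒜 1 := hcd ▸ hd1 y hy0
    have hcc : c * c = 0 := hcd ▸ hdd y hy hy0 y hy hy0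
    have hc0 : c ≠ 0 := hcd ▸ sub_ne_zero.2 hne
    have hw0 : ∀ x ∈ 𝒜 1, c * x + x * c ∈ 𝒜 0 := fun x hx1 =>
      add_mem (odd_mul_odd hc1 hx1) (odd_mul_odd hx1 hc1)
    refine hprime.isCentralOrderInSimple_of_nilpotent h2 hI hI0 hc1 hc0 hcc ?_ ?_ ?_
    · intro w hw hw0
      rw [hcd]
      linear_combination (norm := noncomm_ring)
        hdd _ (hI.mul_mem_right w hy) (even_mul_even hy0 hw0) y hy hy0 - y * hdd w hw hw0 y hy hy0
    · intro x hx hx1 y hy hy1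
      exact he _ (hU11 c hcU hc1 x hx hx1) _ (hU11 c hcU hc1 y hy hy1) (hw0 x hx1) (hw0 y hy1)
    · intro x hx hx1 y hy hy1
      have h := ho _ hcU _ (hU01 _ (hU11 c hcU hc1 x hx hx1) (hw0 x hx1) y hy hy1) hc1
        (sub_mem (even_mul_odd (hw0 x hx1) hy1) (odd_mul_even hy1 (hw0 x hx1)))
      have hcc' : ∀ t, c * (c * t) = 0 := fun t => by rw [← mul_assoc, hcc, zero_mul]
      have h' := congrArg (c * ·) h
      simp only [mul_add, add_mul, mul_sub, sub_mul, mul_assoc, hcc, hcc', mul_zero, add_zero,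
        zero_add, sub_self] at h'
      rw [mul_assoc, mul_assoc, mul_assoc, mul_assoc, mul_assoc, mul_assoc]
      exact sub_eq_zero.1 h'.symm

end Homogeneous

/-! ### Supercommuting pairs -/

section Supercommuting

universe u

variable {R : Type*} {A : Type u} [CommRing R] [NonUnitalRing A] [Module R A]
  [IsScalarTower R A A] [SMulCommClass R A A]
  {𝒜 : ZMod 2 → Submodule R A} [SetLike.GradedMul 𝒜] [DirectSum.Decomposition 𝒜]
  {I : Submodule R A} {L₀ L₁ : Set A} {q : A}

/-- Sets `L₀`, `L₁` of even and odd elements of an ideal `I`, closed under superbrackets with `I`,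
all of whose mutual superbrackets are even central. -/
structure IsSupercommutingPair (𝒜 : ZMod 2 → Submodule R A) (I : Submodule R A)
    (L₀ L₁ : Set A) : Prop where
  even : ∀ x ∈ L₀, x ∈ 𝒜 0
  odd : ∀ x ∈ L₁, x ∈ 𝒜 1
  odd_mem : ∀ x ∈ L₁, x ∈ I
  even_odd : ∀ x ∈ L₀, ∀ y ∈ I, y ∈ 𝒜 1 → x * y - y * x ∈ L₁
  odd_even : ∀ x ∈ L₁, ∀ y ∈ I, y ∈ 𝒜 0 → x * y - y * x ∈ L₁
  odd_odd : ∀ x ∈ L₁, ∀ y ∈ I, y ∈ 𝒜 1 → x * y + y * x ∈ L₀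
  bracket_even : ∀ x ∈ L₀, ∀ y ∈ L₀, x * y - y * x ∈ evenCenter 𝒜
  commute : ∀ x ∈ L₀, ∀ y ∈ L₁, x * y = y * x
  bracket_odd : ∀ x ∈ L₁, ∀ y ∈ L₁, x * y + y * x ∈ evenCenter 𝒜

theorem IsSupercommutingPair.sq_mem (h2 : IsUnit (2 : R)) (hL : IsSupercommutingPair 𝒜 I L₀ L₁)
    (hq : q ∈ L₁) : q * q ∈ evenCenter 𝒜 :=
  evenCenter.of_add_self h2 (hL.bracket_odd q hq q hq)

/-- For `x ∈ I₀` commuting with `q`, the bracket of `q` with `qx` puts `2q²x` into `L₀`; for `y ∈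
I₀` anticommuting with `q`, the bracket puts `2qy` into `L₁`. The pair axioms then make `x` commute
with both kinds of even elements, and these span `A₀` up to the factor `2q²`. -/
theorem IsSupercommutingPair.mem_evenCenter_of_commute (h2 : IsUnit (2 : R))
    (hprime : IsPrimeSuperalgebra 𝒜) (hI : IsSuperideal 𝒜 I)
    (hL : IsSupercommutingPair 𝒜 I L₀ L₁) (hq : q ∈ L₁) (hs0 : q * q ≠ 0) {z : A} (hz : z ∈ 𝒜 0)
    (hqz : q * z = z * q) : z ∈ evenCenter 𝒜 := by
  have hs := hL.sq_mem h2 hq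
  have hq1 := hL.odd q hq
  have hqI := hL.odd_mem q hq
  have hss := evenCenter.mul_mem hs hs
  have hss0 : q * q * (q * q) ≠ 0 := fun h => hs0 (hprime.eq_zero_of_evenCenter_mul hs hs0 h)
  have hcancel : ∀ {x : A}, q * x = 0 → x = 0 := fun {x} h =>
    hprime.eq_zero_of_evenCenter_mul hs hs0 (by rw [mul_assoc, h, mul_zero])
  have hmem : ∀ x ∈ I, x ∈ 𝒜 0 → q * x = x * q → 2 • (q * q * x) ∈ L₀ := by
    intro x hx hx0 hqx
    have e : q * (q * x) + q * x * q = 2 • (q * q * x) := by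
      linear_combination (norm := noncomm_ring) -(q * hqx)
    exact e ▸ hL.odd_odd q hq _ (hI.mul_mem_left q hx) (odd_mul_even hq1 hx0)
  have hbr : ∀ x ∈ I, x ∈ 𝒜 0 → q * x = x * q → ∀ y ∈ I, y ∈ 𝒜 0 → q * y = y * q →
      x * y - y * x ∈ evenCenter 𝒜 := by
    intro x hx hx0 hqx y hy hy0 hqy
    have h := hL.bracket_even _ (hmem x hx hx0 hqx) _ (hmem y hy hy0 hqy)
    have e : 2 • (q * q * x) * (2 • (q * q * y)) - 2 • (q * q * y) * (2 • (q * q * x)) =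
        (q * q * (q * q) * (x * y - y * x) + q * q * (q * q) * (x * y - y * x)) +
        (q * q * (q * q) * (x * y - y * x) + q * q * (q * q) * (x * y - y * x)) := by
      linear_combination (norm := noncomm_ring)
        -(4 • (q * q * hs.2 x * y)) + 4 • (q * q * hs.2 y * x)
    rw [e] at h
    exact hprime.evenCenter_of_mul_mem hss hss0
      (evenCenter.of_add_self h2 (evenCenter.of_add_self h2 h))
  have hcomm : ∀ x ∈ I, x ∈ 𝒜 0 → q * x = x * q → ∀ y ∈ I, y ∈ 𝒜 0 → q * y = y * q →
      x * y = y * x := by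
    intro x hx hx0 hqx y hy hy0 hqy
    have f := hbr x hx hx0 hqx y hy hy0 hqy
    -- Since `[x, xy] = x[x, y]`, a nonzero central `[x, y]` would make `x` itself central.
    have f' := hbr x hx hx0 hqx (x * y) (hI.mul_mem_left x hy) (even_mul_even hx0 hy0)
      (by linear_combination (norm := noncomm_ring) hqx * y + x * hqy)
    have e : x * (x * y) - x * y * x = (x * y - y * x) * x := by
      linear_combination (norm := noncomm_ring) -f.2 x
    rw [e] at f'
    by_contra hne
    exact hne ((hprime.evenCenter_of_mul_mem f (sub_ne_zero.2 hne) f').2 y)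
  have hanti : ∀ x ∈ I, x ∈ 𝒜 0 → q * x = x * q → ∀ y ∈ I, y ∈ 𝒜 0 → q * y = -(y * q) →
      x * y = y * x := by
    intro x hx hx0 hqx y hy hy0 hqy
    have e : q * y - y * q = 2 • (q * y) := by
      linear_combination (norm := noncomm_ring) -hqy
    have h := hL.commute _ (hmem x hx hx0 hqx) _ (e ▸ hL.odd_even q hq y hy hy0)
    rw [← sub_eq_zero]
    apply hcancel
    refine hprime.eq_zero_of_evenCenter_mul hs hs0 (eq_zero_of_add_self h2
      (eq_zero_of_add_self h2 ?_))
    linear_combination (norm := noncomm_ring) h + 4 • (q * q * hqx * y) - 4 • (q * hs.2 y * x)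
  have key : ∀ x ∈ I, x ∈ 𝒜 0 → q * x = x * q → x ∈ evenCenter 𝒜 := by
    intro x hx hx0 hqx
    have hsI : q * q ∈ I := hI.mul_mem_left q hqI
    have hev : ∀ w ∈ 𝒜 0, x * w = w * x := by
      intro w hw
      have m : q * w * q ∈ 𝒜 0 := odd_mul_odd (odd_mul_even hq1 hw) hq1
      have m' : q * q * w ∈ 𝒜 0 := even_mul_even hs.1 hw
      have e1 := hcomm x hx hx0 hqx (q * q * (q * q * w + q * w * q)) (hI.mul_mem_right _ hsI)
        (even_mul_even hs.1 (add_mem m' m))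
        (by linear_combination (norm := noncomm_ring) q * q * mul_symmetrize hs.2 w)
      have e2 := hanti x hx hx0 hqx (q * q * (q * q * w - q * w * q)) (hI.mul_mem_right _ hsI)
        (even_mul_even hs.1 (sub_mem m' m))
        (by linear_combination (norm := noncomm_ring) q * q * mul_antisymmetrize hs.2 w)
      rw [← sub_eq_zero]
      refine hprime.eq_zero_of_evenCenter_mul hss hss0 (eq_zero_of_add_self h2 ?_)
      linear_combination (norm := noncomm_ring) e1 + e2 + 2 • (hss.2 x * w)
    refine ⟨hx0, forall_of_homogeneous 𝒜 (fun a b ha hb => by rw [mul_add, add_mul, ha, hb]) hev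
      fun w hw => ?_⟩
    rw [← sub_eq_zero]
    apply hcancel
    linear_combination (norm := noncomm_ring) hev _ (odd_mul_odd hq1 hw) + hqx * w
  refine hprime.evenCenter_of_mul_mem hs hs0 (key _ (hI.mul_mem_right z (hI.mul_mem_left q hqI))
    (even_mul_even hs.1 hz) ?_)
  linear_combination (norm := noncomm_ring) q * q * hqz

/-- The even elements commuting with `q` lie in `Z`, so everything depends on the even `z`
anticommuting with `q`. If all are zero, `A₀ ⊆ Z` and `A` is commutative. If one has `z² ≠ 0`, then
`z, q` is a quaternion pair. The case of nonzero `z` all of square zero is excluded by `zIz = 0`. -/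
theorem IsSupercommutingPair.commutative_or_isCentralOrderInSimple (h2 : IsUnit (2 : R))
    (hprime : IsPrimeSuperalgebra 𝒜) (hI : IsSuperideal 𝒜 I) (hI0 : I ≠ ⊥)
    (hL : IsSupercommutingPair 𝒜 I L₀ L₁) (hq : q ∈ L₁) (hs0 : q * q ≠ 0) :
    (∀ a b : A, a * b = b * a) ∨ IsCentralOrderInSimple 𝒜 4 := by
  have hs := hL.sq_mem h2 hq
  have hq1 := hL.odd q hq
  have hcancel : ∀ {x : A}, q * x = 0 → x = 0 := fun {x} h =>
    hprime.eq_zero_of_evenCenter_mul hs hs0 (by rw [mul_assoc, h, mul_zero])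
  have hC : ∀ {z : A}, z ∈ 𝒜 0 → q * z = z * q → z ∈ evenCenter 𝒜 := fun hz hqz =>
    hL.mem_evenCenter_of_commute h2 hprime hI hq hs0 hz hqz
  have hplus : ∀ w ∈ 𝒜 0, q * q * w + q * w * q ∈ evenCenter 𝒜 := fun w hw =>
    hC (add_mem (even_mul_even hs.1 hw) (odd_mul_odd (odd_mul_even hq1 hw) hq1))
      (mul_symmetrize hs.2 w)
  have hminus : ∀ w ∈ 𝒜 0, q * q * w - q * w * q ∈ 𝒜 0 := fun w hw =>
    sub_mem (even_mul_even hs.1 hw) (odd_mul_odd (odd_mul_even hq1 hw) hq1)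
  by_cases hz : ∀ z ∈ 𝒜 0, q * z = -(z * q) → z = 0
  · left
    have hev : ∀ x ∈ 𝒜 0, x ∈ evenCenter 𝒜 := by
      intro x hx
      have e := hz _ (hminus x hx) (mul_antisymmetrize hs.2 x)
      refine hprime.evenCenter_of_mul_mem hs hs0 (evenCenter.of_add_self h2 ?_)
      have := hplus x hx
      rwa [← sub_eq_zero.1 e] at this
    have hqx : ∀ x ∈ 𝒜 1, q * x = x * q := by
      intro x hx
      rw [← sub_eq_zero]
      apply hcancel
      linear_combination (norm := noncomm_ring) -(hev _ (odd_mul_odd hq1 hx)).2 q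
    intro a b
    refine forall_of_homogeneous 𝒜 (p := fun a => a * b = b * a)
      (fun x y hx hy => by rw [mul_add, add_mul, hx, hy]) (fun x hx => (hev x hx).2 b) ?_ a
    intro x hx
    refine forall_of_homogeneous 𝒜 (p := fun b => x * b = b * x)
      (fun x y hx hy => by rw [mul_add, add_mul, hx, hy]) (fun y hy => ((hev y hy).2 x).symm) ?_ b
    intro y hy
    rw [← sub_eq_zero]
    apply hcancel
    linear_combination (norm := noncomm_ring) (hev _ (odd_mul_odd hq1 hx)).2 y - hqx y hy * x
  right
  push Not at hz
  obtain ⟨z, hz, hqz, hz0⟩ := hz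
  by_cases hsq : ∀ z ∈ 𝒜 0, q * z = -(z * q) → z * z = 0
  · exfalso
    have hev : ∀ w ∈ 𝒜 0, z * w * z = 0 := by
      intro w hw
      obtain ⟨p, hp⟩ : ∃ p, p = q * q * w - q * w * q := ⟨_, rfl⟩
      have hp0 : p ∈ 𝒜 0 := hp ▸ hminus w hw
      have hqp : q * p = -(p * q) := hp ▸ mul_antisymmetrize hs.2 w
      have e := hsq (z + p) (add_mem hz hp0)
        (by linear_combination (norm := noncomm_ring) hqz + hqp)
      have e1 : z * p * z = 0 := by
        linear_combination (norm := noncomm_ring) e * z - hsq z hz hqz * z - hsq p hp0 hqp * z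
          - p * hsq z hz hqz
      rw [hp] at e1
      refine hprime.eq_zero_of_evenCenter_mul hs hs0 (eq_zero_of_add_self h2 ?_)
      linear_combination (norm := noncomm_ring) e1 + 2 • (hs.2 z * w * z) +
        z * (hplus w hw).2 z + hsq z hz hqz * (q * q * w + q * w * q)
    refine hz0 ((hprime.eq_zero_or_of_mul_mul hI hI0 hz (x := z) ?_).elim id id)
    refine hI.forall_of_homogeneous
      (fun p q hp hq => by rw [mul_add, add_mul, hp, hq, add_zero]) (fun w _ hw => hev w hw) ?_
    intro w _ hw
    apply hcancel
    linear_combination (norm := noncomm_ring) hqz * w * z - hev _ (odd_mul_odd hq1 hw)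
  · push Not at hsq
    obtain ⟨z, hz, hqz, hzz⟩ := hsq
    have hzq : z * q = -(q * z) := by rw [hqz, neg_neg]
    refine hprime.isCentralOrderInSimple_of_odd h2 hz hq1 hzq
      (hC (even_mul_even hz hz) (by linear_combination (norm := noncomm_ring) hqz * z - z * hqz))
      hzz hs hs0 (fun x hx _ hqx => hC hx hqx) ?_
    intro x hx hzx hqx
    have hqxZ := hC (odd_mul_odd hq1 hx) (by linear_combination (norm := noncomm_ring) q * hqx)
    -- The central element `qx` commutes with `z`, while `z` anticommutes with `q` and commutes with
    -- `x`; hence `2qxz = 0`.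
    have e1 : x * z = 0 := by
      apply hcancel
      apply eq_zero_of_add_self h2
      linear_combination (norm := noncomm_ring) hqxZ.2 z + hzq * x - q * hzx
    refine hprime.eq_zero_of_evenCenter_mul
      (hC (even_mul_even hz hz) (by linear_combination (norm := noncomm_ring) hqz * z - z * hqz))
      hzz ?_
    linear_combination (norm := noncomm_ring) z * hzx + z * e1

/-- Polarizing `[q, z]² = 0` makes `qzqwq` antisymmetric in even `z, w`, so `qzqzq = 0`. Moving `w`
to the left, with a sign for even `w` and none for odd `w`, gives `(qzq)I(qzq) = 0`. -/
theorem IsSupercommutingPair.mul_even_mul_eq_zero (h2 : IsUnit (2 : R))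
    (hprime : IsPrimeSuperalgebra 𝒜) (hI : IsSuperideal 𝒜 I) (hI0 : I ≠ ⊥)
    (hL : IsSupercommutingPair 𝒜 I L₀ L₁) (hL1 : ∀ x ∈ L₁, x * x = 0) (hq : q ∈ L₁) :
    ∀ z ∈ I, z ∈ 𝒜 0 → q * z * q = 0 := by
  intro z hz hz0
  have hq1 := hL.odd q hq
  have hqq := hL1 q hq
  have hqq' : ∀ t, q * (q * t) = 0 := fun t => by rw [← mul_assoc, hqq, zero_mul]
  have hsq : ∀ z ∈ I, z ∈ 𝒜 0 → (q * z - z * q) * (q * z - z * q) = 0 := fun z hz hz0 =>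
    hL1 _ (hL.odd_even q hq z hz hz0)
  have hanti : ∀ z ∈ I, z ∈ 𝒜 0 → ∀ w ∈ I, w ∈ 𝒜 0 →
      q * z * q * w * q + q * w * q * z * q = 0 := by
    intro z hz hz0 w hw hw0
    have e := hsq (z + w) (add_mem hz hw) (add_mem hz0 hw0)
    linear_combination (norm := noncomm_ring) q * e - q * hsq z hz hz0 - q * hsq w hw hw0
      - hqq * z * q * w - hqq * w * q * z + hqq * z * w * q + hqq * w * z * q
      + q * z * hqq * w + q * w * hqq * z
  have hzz : q * z * q * z * q = 0 :=
    eq_zero_of_add_self h2 (hanti z hz hz0 z hz hz0)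
  have hcomm : ∀ y ∈ I, y ∈ 𝒜 1 → q * y * q * z * q = q * z * q * y * q := by
    intro y hy hy1
    have e := hL.commute _ (hL.odd_odd q hq y hy hy1) _ (hL.odd_even q hq z hz hz0)
    have e' := congrArg (q * ·) e
    simp only [mul_add, add_mul, mul_sub, sub_mul, mul_assoc, hqq', mul_zero, add_zero,
      zero_add, zero_sub, sub_zero] at e'
    simp only [mul_assoc]
    exact neg_injective (by simpa using e')
  refine (hprime.eq_zero_or_of_mul_mul hI hI0 (odd_mul_odd (odd_mul_even hq1 hz0) hq1)
    (x := q * z * q) ?_).elim id id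
  refine hI.forall_of_homogeneous
    (fun p q hp hq => by rw [mul_add, add_mul, hp, hq, add_zero]) ?_ ?_
  · intro w hw hw0
    linear_combination (norm := noncomm_ring) hanti z hz hz0 w hw hw0 * z * q - q * w * hzz
  · intro w hw hw1
    linear_combination (norm := noncomm_ring) -(hcomm w hw hw1 * z * q) + q * w * hzz

/-- The central bracket `f` of `qx + xq` and `qy + yq` satisfies `fq = qxqyq - qyqxq`. Replacing `y`
by `xqy` gives `fqxq = gq` with `g` central, which makes the two terms of `f²q` equal; so `f = 0`.
-/
theorem IsSupercommutingPair.commute_odd_sandwich (hprime : IsPrimeSuperalgebra 𝒜) (hI : IsSuperideal 𝒜 I)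
    (hL : IsSupercommutingPair 𝒜 I L₀ L₁) (hq : q ∈ L₁) (hqq : q * q = 0) (hq0 : q ≠ 0) :
    ∀ x ∈ I, x ∈ 𝒜 1 → ∀ y ∈ I, y ∈ 𝒜 1 → q * x * q * y * q = q * y * q * x * q := by
  have hq1 := hL.odd q hq
  have hw : ∀ x ∈ I, x ∈ 𝒜 1 → q * x + x * q ∈ L₀ := hL.odd_odd q hq
  have hqq' : ∀ t, q * (q * t) = 0 := fun t => by rw [← mul_assoc, hqq, zero_mul]
  have hbr : ∀ x y, ((q * x + x * q) * (q * y + y * q) - (q * y + y * q) * (q * x + x * q)) * q =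
      q * x * q * y * q - q * y * q * x * q := fun x y => by
    simp [mul_add, add_mul, sub_mul, mul_assoc, hqq, hqq']
  intro x hx hx1 y hy hy1
  have hv1 : x * q * y ∈ 𝒜 1 := even_mul_odd (odd_mul_odd hx1 hq1) hy1
  have hf := hL.bracket_even _ (hw x hx hx1) _ (hw y hy hy1)
  have hg := hL.bracket_even _ (hw x hx hx1) _ (hw (x * q * y) (hI.mul_mem_left _ hy) hv1)
  have ef := hbr x y
  have eg := hbr x (x * q * y)
  generalize (q * x + x * q) * (q * y + y * q) - (q * y + y * q) * (q * x + x * q) = f at hf ef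
  generalize (q * x + x * q) * (q * (x * q * y) + x * q * y * q) -
    (q * (x * q * y) + x * q * y * q) * (q * x + x * q) = g at hg eg
  have h1 : f * q * x * q = g * q := by
    linear_combination (norm := noncomm_ring) hf.2 (q * x) * q + q * x * ef - eg
  have h2 : f * (f * q) = 0 := by
    linear_combination (norm := noncomm_ring) f * ef + h1 * y * q - hf.2 (q * y) * q * x * q
      - q * y * h1 + hg.2 (q * y) * q
  by_contra hne
  have hf0 : f ≠ 0 := fun h => hne (sub_eq_zero.1 (by rw [← ef, h, zero_mul]))
  exact hq0 (hprime.eq_zero_of_evenCenter_mul hf hf0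
    (hprime.eq_zero_of_evenCenter_mul hf hf0 h2))

/-- Commutators are shown to vanish by testing them against `qI` on the left or `Iq` on the right.
The symmetry of `qvqy` and of `vqyq` in odd `v, y` shows that `qx` and `xq` each commute with `I₀`;
the sum is then tested against `I₁`. -/
theorem IsSupercommutingPair.anticommutator_mem_evenCenter (h2 : IsUnit (2 : R))
    (hprime : IsPrimeSuperalgebra 𝒜) (hI : IsSuperideal 𝒜 I) (hI0 : I ≠ ⊥)
    (hL : IsSupercommutingPair 𝒜 I L₀ L₁) (hL1 : ∀ x ∈ L₁, x * x = 0) (hq : q ∈ L₁)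
    (hq0 : q ≠ 0) {x : A} (hx : x ∈ I) (hx1 : x ∈ 𝒜 1) : q * x + x * q ∈ evenCenter 𝒜 := by
  have hq1 := hL.odd q hq
  have hqq := hL1 q hq
  have hev := hL.mul_even_mul_eq_zero h2 hprime hI hI0 hL1 hq
  have hodd := hL.commute_odd_sandwich hprime hI hq hqq hq0
  have hw : ∀ x ∈ I, x ∈ 𝒜 1 → q * x + x * q ∈ L₀ := hL.odd_odd q hq
  have hcomm : ∀ x ∈ I, x ∈ 𝒜 1 → ∀ v ∈ I, v ∈ 𝒜 1 → ∀ y ∈ I, y ∈ 𝒜 1 →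
      (q * x + x * q) * ((q * v + v * q) * y - y * (q * v + v * q)) =
        ((q * v + v * q) * y - y * (q * v + v * q)) * (q * x + x * q) :=
    fun x hx hx1 v hv hv1 y hy hy1 =>
      hL.commute _ (hw x hx hx1) _ (hL.even_odd _ (hw v hv hv1) y hy hy1)
  have hleft : ∀ {g : A} {i : ZMod 2}, g ∈ 𝒜 i → (∀ w ∈ I, w ∈ 𝒜 0 → q * w * g = 0) →
      (∀ w ∈ I, w ∈ 𝒜 1 → q * w * g = 0) → g = 0 := fun hg h0 h1 =>
    (hprime.eq_zero_or_of_mul_mul hI hI0 hg (hI.forall_of_homogeneous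
      (fun p r hp hr => by rw [mul_add, add_mul, hp, hr, add_zero]) h0 h1)).resolve_left hq0
  have hright : ∀ {g : A}, (∀ w ∈ I, w ∈ 𝒜 0 → g * w * q = 0) →
      (∀ w ∈ I, w ∈ 𝒜 1 → g * w * q = 0) → g = 0 := fun h0 h1 =>
    (hprime.eq_zero_or_of_mul_mul hI hI0 hq1 (hI.forall_of_homogeneous
      (fun p r hp hr => by rw [mul_add, add_mul, hp, hr, add_zero]) h0 h1)).resolve_right hq0
  have hg : ∀ v ∈ I, v ∈ 𝒜 1 → ∀ y ∈ I, y ∈ 𝒜 1 → q * v * q * y - q * y * q * v = 0 := by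
    intro v hv hv1 y hy hy1
    refine hleft (i := 0) (sub_mem (odd_mul_odd (even_mul_odd (odd_mul_odd hq1 hv1) hq1) hy1)
      (odd_mul_odd (even_mul_odd (odd_mul_odd hq1 hy1) hq1) hv1)) ?_ ?_
    · intro w hw hw0
      linear_combination (norm := noncomm_ring) hev w hw hw0 * v * q * y - hev w hw hw0 * y * q * v
    · intro x hx hx1
      have eyv := hev _ (hI.mul_mem_right v hy) (odd_mul_odd hy1 hv1)
      have eyx := hev _ (hI.mul_mem_right x hy) (odd_mul_odd hy1 hx1)
      have evx := hev _ (hI.mul_mem_right x hv) (odd_mul_odd hv1 hx1)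
      linear_combination (norm := noncomm_ring) q * hcomm x hx hx1 v hv hv1 y hy hy1
        - hqq * x * ((q * v + v * q) * y - y * (q * v + v * q)) + hqq * v * y * q * x
        + hodd v hv hv1 y hy hy1 * x - eyv * q * x + hqq * v * y * x * q + q * v * eyx
        - q * y * evx - eyv * x * q - q * x * hqq * v * y + q * x * eyv
  have hg' : ∀ v ∈ I, v ∈ 𝒜 1 → ∀ y ∈ I, y ∈ 𝒜 1 → v * q * y * q - y * q * v * q = 0 := by
    intro v hv hv1 y hy hy1
    refine hright ?_ ?_
    · intro w hw hw0
      linear_combination (norm := noncomm_ring) v * q * y * hev w hw hw0 - y * q * v * hev w hw hw0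
    · intro x hx hx1
      have evy := hev _ (hI.mul_mem_right y hv) (odd_mul_odd hv1 hy1)
      have exv := hev _ (hI.mul_mem_right v hx) (odd_mul_odd hx1 hv1)
      have exy := hev _ (hI.mul_mem_right y hx) (odd_mul_odd hx1 hy1)
      linear_combination (norm := noncomm_ring) -(hcomm x hx hx1 v hv hv1 y hy hy1 * q)
        + q * x * evy + x * q * evy + exv * y * q + x * hodd v hv hv1 y hy hy1 - exy * v * q
        - q * x * y * v * hqq - x * q * y * v * hqq - evy * x * q + y * v * hqq * x * q
        - q * v * y * x * hqq - v * q * y * x * hqq + y * q * v * x * hqq + y * v * q * x * hqq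
  have hz : ∀ z ∈ I, z ∈ 𝒜 0 → q * x * z = z * (q * x) := by
    intro z hz hz0
    rw [← sub_eq_zero]
    refine hleft (i := 0) (sub_mem (even_mul_even (odd_mul_odd hq1 hx1) hz0)
      (even_mul_even hz0 (odd_mul_odd hq1 hx1))) ?_ ?_
    · intro w hw hw0
      linear_combination (norm := noncomm_ring) hev w hw hw0 * x * z
        - hev _ (hI.mul_mem_right z hw) (even_mul_even hw0 hz0) * x
    · intro y hy hy1
      linear_combination (norm := noncomm_ring) -(hg x hx hx1 y hy hy1 * z)
        + hg x hx hx1 _ (hI.mul_mem_right z hy) (odd_mul_even hy1 hz0)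
  have hz' : ∀ z ∈ I, z ∈ 𝒜 0 → x * q * z = z * (x * q) := by
    intro z hz hz0
    rw [← sub_eq_zero]
    refine hright ?_ ?_
    · intro w hw hw0
      linear_combination (norm := noncomm_ring)
        x * hev _ (hI.mul_mem_left z hw) (even_mul_even hz0 hw0) - z * x * hev w hw hw0
    · intro y hy hy1
      linear_combination (norm := noncomm_ring) -(z * hg' x hx hx1 y hy hy1)
        + hg' x hx hx1 _ (hI.mul_mem_left z hy) (even_mul_odd hz0 hy1)
  have hwz : ∀ z ∈ I, z ∈ 𝒜 0 → (q * x + x * q) * z = z * (q * x + x * q) := fun z hzI hz0 => by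
    rw [add_mul, mul_add, hz z hzI hz0, hz' z hzI hz0]
  have hw0 : q * x + x * q ∈ 𝒜 0 := add_mem (odd_mul_odd hq1 hx1) (odd_mul_odd hx1 hq1)
  have hqW : ∀ y ∈ I, y ∈ 𝒜 1 → q * ((q * x + x * q) * y - y * (q * x + x * q)) = 0 := by
    intro y hy hy1
    linear_combination (norm := noncomm_ring) hqq * x * y + hg x hx hx1 y hy hy1
      - hev _ (hI.mul_mem_right x hy) (odd_mul_odd hy1 hx1)
  refine ⟨hw0, hprime.commute_of_commute_ideal hI hI0 (hI.forall_of_homogeneous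
    (fun p r hp hr => by rw [mul_add, hp, hr, ← add_mul]) hwz fun y hy hy1 => ?_)⟩
  rw [← sub_eq_zero]
  refine hleft (i := 1) (sub_mem (even_mul_odd hw0 hy1) (odd_mul_even hy1 hw0)) ?_ ?_
  · intro w hw hw0
    linear_combination (norm := noncomm_ring)
      hqW _ (hI.mul_mem_left w hy) (even_mul_odd hw0 hy1) - q * hwz w hw hw0 * y
  · intro w hw hw1
    linear_combination (norm := noncomm_ring)
      q * hwz _ (hI.mul_mem_left w hy) (odd_mul_odd hw1 hy1) - hqW w hw hw1 * y

/-- The odd part of a supercommuting pair is trivial, unless `A` is commutative or a central order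
in a quaternion algebra. -/
theorem IsSupercommutingPair.trichotomy (h2 : IsUnit (2 : R))
    (hprime : IsPrimeSuperalgebra 𝒜) (hI : IsSuperideal 𝒜 I) (hI0 : I ≠ ⊥)
    (hL : IsSupercommutingPair 𝒜 I L₀ L₁) :
    (∀ a b : A, a * b = b * a) ∨ IsCentralOrderInSimple 𝒜 4 ∨ ∀ q ∈ L₁, q = 0 := by
  by_cases hL1 : ∀ x ∈ L₁, x * x = 0
  · by_cases h0 : ∀ q ∈ L₁, q = 0
    · exact Or.inr (Or.inr h0)
    push Not at h0
    obtain ⟨q, hq, hq0⟩ := h0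
    have hZ : ∀ x ∈ I, x ∈ 𝒜 1 → q * x + x * q ∈ evenCenter 𝒜 := fun x hx hx1 =>
      hL.anticommutator_mem_evenCenter h2 hprime hI hI0 hL1 hq hq0 hx hx1
    refine Or.inr (Or.inl (hprime.isCentralOrderInSimple_of_nilpotent h2 hI hI0 (hL.odd q hq) hq0
      (hL1 q hq) (hL.mul_even_mul_eq_zero h2 hprime hI hI0 hL1 hq) ?_
      (hL.commute_odd_sandwich hprime hI hq (hL1 q hq) hq0)))
    exact fun x hx hx1 y hy hy1 => evenCenter.add_mem
      (evenCenter.mul_mem (hZ x hx hx1) (hZ y hy hy1))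
      (evenCenter.mul_mem (hZ y hy hy1) (hZ x hx hx1))
  · push Not at hL1
    obtain ⟨q, hq, hs0⟩ := hL1
    rcases hL.commutative_or_isCentralOrderInSimple h2 hprime hI hI0 hq hs0 with h | h
    · exact Or.inl h
    · exact Or.inr (Or.inl h)

end Supercommuting

/-! ### Non-homogeneous elements of `U` -/

section General

universe u

variable {R : Type*} {A : Type u} [CommRing R] [NonUnitalRing A] [Module R A]
  [IsScalarTower R A A] [SMulCommClass R A A]
  {𝒜 : ZMod 2 → Submodule R A} [SetLike.GradedMul 𝒜] [DirectSum.Decomposition 𝒜]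
  {I : Submodule R A} {U : AddSubgroup A}

theorem superbracket_mem_even (hUI : ∀ u ∈ U, ∀ y ∈ I, superbracket 𝒜 u y ∈ U) {x w : A}
    (hx : x ∈ 𝒜 0) (hw : w ∈ 𝒜 1) (hU : x + w ∈ U) {y : A} (hy : y ∈ I) (hy0 : y ∈ 𝒜 0) :
    (x * y - y * x) + (w * y - y * w) ∈ U := by
  have := hUI _ hU y hy
  rwa [superbracket_even_right 𝒜 _ hy0, comp_add, comp_add, comp_of_mem 𝒜 hx, comp_of_mem 𝒜 hw,
    comp_of_mem_ne 𝒜 hx (by decide), comp_of_mem_ne 𝒜 hw (by decide), add_zero, zero_add] at this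

theorem superbracket_mem_odd (hUI : ∀ u ∈ U, ∀ y ∈ I, superbracket 𝒜 u y ∈ U) {x w : A}
    (hx : x ∈ 𝒜 0) (hw : w ∈ 𝒜 1) (hU : x + w ∈ U) {y : A} (hy : y ∈ I) (hy1 : y ∈ 𝒜 1) :
    (w * y + y * w) + (x * y - y * x) ∈ U := by
  have := hUI _ hU y hy
  rwa [superbracket_odd_right 𝒜 _ hy1, comp_add, comp_add, comp_of_mem 𝒜 hx, comp_of_mem 𝒜 hw,
    comp_of_mem_ne 𝒜 hx (by decide), comp_of_mem_ne 𝒜 hw (by decide), add_zero, zero_add,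
    add_comm] at this

/-- If the homogeneous elements of `U` are even central, the homogeneous components of the
elements of `U ∩ I` form a supercommuting pair. -/
theorem isSupercommutingPair_components (h2 : IsUnit (2 : R)) (hI : IsSuperideal 𝒜 I)
    (hUI : ∀ u ∈ U, ∀ y ∈ I, superbracket 𝒜 u y ∈ U)
    (hZ : ∀ u ∈ U, u ∈ 𝒜 0 → u ∈ evenCenter 𝒜) (hZ1 : ∀ u ∈ U, u ∈ 𝒜 1 → u = 0) :
    IsSupercommutingPair 𝒜 I {x | x ∈ 𝒜 0 ∧ x ∈ I ∧ ∃ w ∈ 𝒜 1, w ∈ I ∧ x + w ∈ U}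
      {w | w ∈ 𝒜 1 ∧ w ∈ I ∧ ∃ x ∈ 𝒜 0, x ∈ I ∧ x + w ∈ U} := by
  have key : ∀ {x w x' w' : A}, x ∈ 𝒜 0 → w ∈ 𝒜 1 → x ∈ I → w ∈ I → x + w ∈ U →
      x' ∈ 𝒜 0 → w' ∈ 𝒜 1 → x' ∈ I → w' ∈ I → x' + w' ∈ U →
      x * x' - x' * x ∈ evenCenter 𝒜 ∧ x * w' = w' * x ∧ w * w' + w' * w ∈ evenCenter 𝒜 := by
    intro x w x' w' hx hw hxI hwI hU hx' hw' hxI' hwI' hU'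
    have e1 := superbracket_mem_even hUI hx hw hU hxI' hx'
    have e2 := superbracket_mem_odd hUI hx hw hU hwI' hw'
    have e3 := superbracket_mem_even hUI hx' hw' hU' hxI hx
    have e4 := superbracket_mem_odd hUI hx' hw' hU' hwI hw
    have m1 : w * x' - x' * w ∈ 𝒜 1 := sub_mem (odd_mul_even hw hx') (even_mul_odd hx' hw)
    have m2 : x * w' - w' * x ∈ 𝒜 1 := sub_mem (even_mul_odd hx hw') (odd_mul_even hw' hx)
    -- Adding the brackets of `x + w` with `x'` and of `x' + w'` with `x` cancels the even parts,
    -- leaving an odd element of `U`. The difference of the brackets with `w'` and `w` gives the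
    -- companion relation `a2`.
    have a1 : (w * x' - x' * w) - (x * w' - w' * x) = 0 := by
      refine hZ1 _ ?_ (sub_mem m1 m2)
      have e := add_mem e1 e3
      convert e using 1
      abel
    have a2 : (x * w' - w' * x) + (w * x' - x' * w) = 0 := by
      refine hZ1 _ ?_ (add_mem m2 m1)
      have e := sub_mem e2 e4
      convert e using 1
      abel
    have a3 : x * w' - w' * x = 0 := by
      apply eq_zero_of_add_self h2
      linear_combination (norm := noncomm_ring) a2 - a1
    have a4 : w * x' - x' * w = 0 := by
      linear_combination (norm := noncomm_ring) a2 - a3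
    rw [a4, add_zero] at e1
    rw [a3, add_zero] at e2
    exact ⟨hZ _ e1 (sub_mem (even_mul_even hx hx') (even_mul_even hx' hx)), sub_eq_zero.1 a3,
      hZ _ e2 (add_mem (odd_mul_odd hw hw') (odd_mul_odd hw' hw))⟩
  constructor
  · exact fun x hx => hx.1
  · exact fun x hx => hx.1
  · exact fun x hx => hx.2.1
  · rintro x ⟨hx, hxI, w, hw, hwI, hU⟩ y hy hy1
    exact ⟨sub_mem (even_mul_odd hx hy1) (odd_mul_even hy1 hx),
      sub_mem (hI.mul_mem_left x hy) (hI.mul_mem_right x hy), _,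
      add_mem (odd_mul_odd hw hy1) (odd_mul_odd hy1 hw),
      add_mem (hI.mul_mem_left w hy) (hI.mul_mem_right w hy),
      superbracket_mem_odd hUI hx hw hU hy hy1⟩
  · rintro w ⟨hw, hwI, x, hx, hxI, hU⟩ y hy hy0
    exact ⟨sub_mem (odd_mul_even hw hy0) (even_mul_odd hy0 hw),
      sub_mem (hI.mul_mem_left w hy) (hI.mul_mem_right w hy), _,
      sub_mem (even_mul_even hx hy0) (even_mul_even hy0 hx),
      sub_mem (hI.mul_mem_left x hy) (hI.mul_mem_right x hy),
      superbracket_mem_even hUI hx hw hU hy hy0⟩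
  · rintro w ⟨hw, hwI, x, hx, hxI, hU⟩ y hy hy1
    exact ⟨add_mem (odd_mul_odd hw hy1) (odd_mul_odd hy1 hw),
      add_mem (hI.mul_mem_left w hy) (hI.mul_mem_right w hy), _,
      sub_mem (even_mul_odd hx hy1) (odd_mul_even hy1 hx),
      sub_mem (hI.mul_mem_left x hy) (hI.mul_mem_right x hy),
      superbracket_mem_odd hUI hx hw hU hy hy1⟩
  · rintro x ⟨hx, hxI, w, hw, hwI, hU⟩ x' ⟨hx', hxI', w', hw', hwI', hU'⟩
    exact (key hx hw hxI hwI hU hx' hw' hxI' hwI' hU').1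
  · rintro x ⟨hx, hxI, w, hw, hwI, hU⟩ w' ⟨hw', hwI', x', hx', hxI', hU'⟩
    exact (key hx hw hxI hwI hU hx' hw' hxI' hwI' hU').2.1
  · rintro w ⟨hw, hwI, x, hx, hxI, hU⟩ w' ⟨hw', hwI', x', hx', hxI', hU'⟩
    exact (key hx hw hxI hwI hU hx' hw' hxI' hwI' hU').2.2

/-- If the homogeneous elements of `U` are even central, then so are all elements of `U`, unless
`A` is commutative or a central order in a quaternion algebra. -/
theorem IsPrimeSuperalgebra.subset_evenCenter_of_homogeneous (h2 : IsUnit (2 : R))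
    (hprime : IsPrimeSuperalgebra 𝒜) (hI : IsSuperideal 𝒜 I) (hI0 : I ≠ ⊥)
    (hUI : ∀ u ∈ U, ∀ y ∈ I, superbracket 𝒜 u y ∈ U)
    (hZ : ∀ u ∈ U, u ∈ 𝒜 0 → u ∈ evenCenter 𝒜) (hZ1 : ∀ u ∈ U, u ∈ 𝒜 1 → u = 0) :
    (∀ a b : A, a * b = b * a) ∨ IsCentralOrderInSimple 𝒜 4 ∨ (U : Set A) ⊆ evenCenter 𝒜 := by
  have hL := isSupercommutingPair_components h2 hI hUI hZ hZ1
  rcases hL.trichotomy h2 hprime hI hI0 with h | h | hL1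
  · exact Or.inl h
  · exact Or.inr (Or.inl h)
  by_cases hU1 : ∀ u ∈ U, comp 𝒜 u 1 = 0
  · refine Or.inr (Or.inr fun u hu => hZ u hu ?_)
    rw [← comp_add_comp 𝒜 u, hU1 u hu, add_zero]
    exact comp_mem_grade 𝒜 u 0
  push Not at hU1
  obtain ⟨u, hu, hq0⟩ := hU1
  left
  obtain ⟨x, hxd⟩ : ∃ x, x = comp 𝒜 u 0 := ⟨_, rfl⟩
  obtain ⟨q, hqd⟩ : ∃ q, q = comp 𝒜 u 1 := ⟨_, rfl⟩
  have hx0 : x ∈ 𝒜 0 := hxd ▸ comp_mem_grade 𝒜 u 0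
  have hq1 : q ∈ 𝒜 1 := hqd ▸ comp_mem_grade 𝒜 u 1
  rw [← comp_add_comp 𝒜 u, ← hxd, ← hqd] at hu
  rw [← hqd] at hq0
  -- For `y ∈ I₀` the commutator `[q, y]` is the odd part of an element of `U ∩ I`, hence zero,
  -- although `u` itself need not lie in `I`.
  have hqc : ∀ a, q * a = a * q :=
    hprime.odd_commute_of_commute_even hI hI0 hq1 fun y hy hy0 => sub_eq_zero.1 <| hL1 _
      ⟨sub_mem (odd_mul_even hq1 hy0) (even_mul_odd hy0 hq1),
        sub_mem (hI.mul_mem_left q hy) (hI.mul_mem_right q hy), _,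
        sub_mem (even_mul_even hx0 hy0) (even_mul_even hy0 hx0),
        sub_mem (hI.mul_mem_left x hy) (hI.mul_mem_right x hy),
        superbracket_mem_even hUI hx0 hq1 hu hy hy0⟩
  have hs : q * q ∈ evenCenter 𝒜 :=
    ⟨odd_mul_odd hq1 hq1, fun a => by rw [mul_assoc, hqc, ← mul_assoc, hqc, mul_assoc]⟩
  have hs0 := hprime.sq_ne_zero_of_central hI hI0 hq1 hq0 hqc
  have hqy : ∀ y ∈ I, y ∈ 𝒜 1 → q * y + y * q ∈ evenCenter 𝒜 := by
    intro y hy hy1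
    have hm := superbracket_mem_odd hUI hx0 hq1 hu hy hy1
    have e0 : q * y + y * q ∈ 𝒜 0 := add_mem (odd_mul_odd hq1 hy1) (odd_mul_odd hy1 hq1)
    have e1 : x * y - y * x ∈ 𝒜 1 := sub_mem (even_mul_odd hx0 hy1) (odd_mul_even hy1 hx0)
    have h0 : x * y - y * x = 0 := hL1 _ ⟨e1,
      sub_mem (hI.mul_mem_left x hy) (hI.mul_mem_right x hy), _, e0,
      add_mem (hI.mul_mem_left q hy) (hI.mul_mem_right q hy), hm⟩
    rw [h0, add_zero] at hm
    exact hZ _ hm e0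
  -- Applied to the odd element `qy`, `hqy` says that `2q²y` is central.
  have hIZ : ∀ y ∈ I, y ∈ 𝒜 0 → y ∈ evenCenter 𝒜 := by
    intro y hy hy0
    refine hprime.evenCenter_of_mul_mem hs hs0 (evenCenter.of_add_self h2 ?_)
    have h := hqy _ (hI.mul_mem_left q hy) (odd_mul_even hq1 hy0)
    rwa [← hqc (q * y), ← mul_assoc] at h
  exact hprime.commutative_of_odd_central hI hI0 hq1 hq0 hqc
    fun x hx hx0 y _ _ => (hIZ x hx hx0).2 y

end General

end Superalgebra

open Superalgebra in
theorem theorem2p4 {R A : Type*} [CommRing R] (h2 : IsUnit (2 : R))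
    [NonUnitalRing A] [Module R A] [IsScalarTower R A A] [SMulCommClass R A A]
    (𝒜 : ZMod 2 → Submodule R A) [SetLike.GradedMul 𝒜] [DirectSum.Decomposition 𝒜]
    (hprime : IsPrimeSuperalgebra 𝒜)
    (I : Submodule R A) (hI : IsSuperideal 𝒜 I) (hI_ne_bot : I ≠ ⊥) (hI_ne_top : I ≠ ⊤)
    (U : AddSubgroup A)
    (hUI : ∀ u ∈ U, ∀ y ∈ I, superbracket 𝒜 u y ∈ U)
    (heven : ∀ u ∈ U, ∀ v ∈ U, u ∈ 𝒜 0 → v ∈ 𝒜 0 → superjordan 𝒜 u v ∈ evenCenter 𝒜)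
    (hodd : ∀ u ∈ U, ∀ v ∈ U, u ∈ 𝒜 1 → v ∈ 𝒜 1 → superjordan 𝒜 u v = 0) :
    (∀ a b : A, a * b = b * a) ∨ IsCentralOrderInSimple 𝒜 4 ∨ (U : Set A) ⊆ evenCenter 𝒜 := by
  have hU0 : ∀ u ∈ U, u ∈ 𝒜 0 → ∀ y ∈ I, y ∈ 𝒜 0 → u * y - y * u ∈ U := by
    intro u hu hu0 y hy hy0
    simpa using superbracket_mem_even hUI hu0 (zero_mem _) (by rwa [add_zero]) hy hy0
  have hU1 : ∀ u ∈ U, u ∈ 𝒜 1 → ∀ y ∈ I, y ∈ 𝒜 0 → u * y - y * u ∈ U := by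
    intro u hu hu1 y hy hy0
    simpa using superbracket_mem_even hUI (zero_mem _) hu1 (by rwa [zero_add]) hy hy0
  have hdich : ∀ i : ZMod 2, i = 0 ∨ i = 1 := by decide
  rcases hprime.homogeneous_trichotomy h2 hI hI_ne_bot U
    (fun u hu i hui => by
      rcases hdich i with rfl | rfl
      exacts [hU0 u hu hui, hU1 u hu hui])
    (fun u hu hu0 y hy hy1 => by
      simpa using superbracket_mem_odd hUI hu0 (zero_mem _) (by rwa [add_zero]) hy hy1)
    (fun u hu hu1 y hy hy1 => by
      simpa using superbracket_mem_odd hUI (zero_mem _) hu1 (by rwa [zero_add]) hy hy1)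
    (fun u hu v hv hu0 hv0 => superjordan_even 𝒜 hu0 hv0 ▸ heven u hu v hv hu0 hv0)
    (fun u hu v hv hu1 hv1 => sub_eq_zero.1 (superjordan_odd 𝒜 hu1 hv1 ▸ hodd u hu v hv hu1 hv1))
    with h | h | ⟨hZ, hZ1⟩
  · exact Or.inl h
  · exact Or.inr (Or.inl h)
  · exact hprime.subset_evenCenter_of_homogeneous h2 hI hI_ne_bot hUI hZ hZ1
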